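/- Let $\mathbb{D}=\{z\in\mathbb{C}:|z|<1\}$, let $\mathcal{A}$ be the class of analytic functions $f:\mathbb{D}\to\mathbb{C}$ with $f(0)=0$, $f'(0)=1$, and let $\mathcal{S}\subset\mathcal{A}$ be the subclass of univalent functions. Put $s_f(z)=zf'(z)/f(z)$ (with $s_f(0)=1$). For $0\le\alpha<1$ let $\mathcal{S}^*(\alpha)=\{f\in\mathcal{S}:\operatorname{Re}s_f(z)>\alpha \text{ for } z\in\mathbb{D}\}$. For an analytic function $\varphi$ on $\mathbb{D}$ let $\mathcal{S}^*(\varphi)$ be the class of $f\in\mathcal{A}$, with no zero in $\mathbb{D}\setminus\{0\}$, such that $s_f\prec\varphi$, that is, $s_f=\varphi\circ\omega$ on $\mathbb{D}$ for some analytic $\omega:\mathbb{D}\to\mathbb{D}$ with $\omega(0)=0$. Write $\mathcal{S}^*_P,\mathcal{S}^*_e,\mathcal{S}^*_{\sin},\mathcal{S}^*_{☾},\mathcal{S}^*_R,\mathcal{S}^*_C$ for $\mathcal{S}^*(\varphi)$ with $\varphi(z)$ equal to, respectively, $$1+\frac{2}{\pi^2}\Bigl(\log\frac{1+\sqrt z}{1-\sqrt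 z}\Bigr)^2,\quad e^z,\quad 1+\sin z,\quad z+\sqrt{1+z^2},\quad 1+\frac{kz+z^2}{k^2-kz}\ (k=\sqrt2+1),\quad 1+\tfrac43z+\tfrac23z^2 .$$ For $\mathcal{F},\mathcal{G}\subset\mathcal{A}$ the $\mathcal{G}$ radius $R_{\mathcal{G}}$ of $\mathcal{F}$ is the largest $R\in[0,1]$ such that for every $0<r<R$ and every $f\in\mathcal{F}$ the function $z\mapsto f(rz)/r$ belongs to $\mathcal{G}$. Let $$\mathcal{F}_2=\Bigl\{f\in\mathcal{A}:\ \Bigl|\frac{f(z)}{g(z)}-1\Bigr|<1 \text{ and } \operatorname{Re}\frac{g(z)}{z+z^2/2}>0 \text{ on } \mathbb{D}, \text{ for some } g\in\mathcal{A}\Bigr\}$$ (both quotients take their limit value $1$ at $z=0$). The following sharp radius results hold for $\mathcal{F}=\mathcal{F}_2$: (i) for every $0\le\alpha<1$, $R_{\mathcal{S}^*(\alpha)}$ is the smallest positive root of $(3-\alpha)r^3+(2\alpha-1)r^2-(8-\alpha)r+2-2\alpha=0$; (ii) $R_{\mathcal{S}^*_P}=R_{\mathcal{S}^*(1/2)}$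 $(\approx 0.1341)$; (iii) $R_{\mathcal{S}^*_e}=R_{\mathcal{S}^*(1/e)}$ $(\approx 0.16628)$; (iv) $R_{\mathcal{S}^*_{\sin}}=R_{\mathcal{S}^*(1-\sin 1)}$ $(\approx 0.2142)$; (v) $R_{\mathcal{S}^*_{☾}}=R_{\mathcal{S}^*(\sqrt2-1)}$ $(\approx 0.1551)$; (vi) $R_{\mathcal{S}^*_R}=R_{\mathcal{S}^*(2(\sqrt2-1))}$ $(\approx 0.0481)$; (vii) $R_{\mathcal{S}^*_C}=R_{\mathcal{S}^*(1/3)}$ $(\approx 0.1744)$. Here each approximate value is correct to within one unit of its last digit. The function $f_2(z)=(1+z)^2(z+z^2/2)/(1-z)$ is extremal in all cases: $f_2\in\mathcal{F}_2$, and for each class $\mathcal{G}$ above and each $r$ with $R_{\mathcal{G}}<r\le1$, the function $z\mapsto f_2(rz)/r$ is not in $\mathcal{G}$; moreover $s_{f_2}(-R_{\mathcal{S}^*(\alpha)})=\alpha$ for every $0\le\alpha<1$. -/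

import Mathlib

open Set Metric

noncomputable section

namespace StarRadius

/-- The open unit disk `𝔻` in the complex plane. -/
def unitDisk : Set ℂ := ball (0 : ℂ) 1

/-- The class `𝒜` of analytic functions `f` on the unit disk with `f 0 = 0` and `f' 0 = 1`. -/
def classA : Set (ℂ → ℂ) :=
  {f | DifferentiableOn ℂ f unitDisk ∧ f 0 = 0 ∧ deriv f 0 = 1}

/-- The class `𝒮` of univalent functions in `𝒜`. -/
def classS : Set (ℂ → ℂ) := {f | f ∈ classA ∧ InjOn f unitDisk}

/-- The function `s_f z = z f'(z) / f(z)`, whose (removable) value at the origin is `1` for every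
`f ∈ 𝒜`. -/
def starQuot (f : ℂ → ℂ) (z : ℂ) : ℂ := if z = 0 then 1 else z * deriv f z / f z

/-- The class `𝒮*(α)` of functions starlike of order `α`. -/
def starlikeOrder (α : ℝ) : Set (ℂ → ℂ) :=
  {f | f ∈ classS ∧ ∀ z ∈ unitDisk, α < (starQuot f z).re}

/-- Subordination `h ≺ φ`: `h = φ ∘ ω` on the unit disk for some analytic self-map `ω` of the unit
disk that fixes the origin. -/
def Subordinate (h φ : ℂ → ℂ) : Prop :=
  ∃ ω : ℂ → ℂ, DifferentiableOn ℂ ω unitDisk ∧ MapsTo ω unitDisk unitDisk ∧ ω 0 = 0 ∧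
    ∀ z ∈ unitDisk, h z = φ (ω z)

/-- The class `𝒮*(φ)` of functions `f ∈ 𝒜` with `s_f ≺ φ`; that `s_f` is defined on the unit disk
means that `f` has no zero other than the origin. -/
def starlikeSub (φ : ℂ → ℂ) : Set (ℂ → ℂ) :=
  {f | f ∈ classA ∧ (∀ z ∈ unitDisk, z ≠ 0 → f z ≠ 0) ∧ Subordinate (starQuot f) φ}

/-- `φ z = 1 + (2/π²) (log ((1 + √z)/(1 - √z)))²`, parabolic starlikeness. -/
def phiP (z : ℂ) : ℂ :=
  1 + 2 * Complex.log ((1 + z ^ (1 / 2 : ℂ)) / (1 - z ^ (1 / 2 : ℂ))) ^ 2 / (Real.pi : ℂ) ^ 2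

/-- `φ z = e^z`, exponential starlikeness. -/
def phiE (z : ℂ) : ℂ := Complex.exp z

/-- `φ z = 1 + sin z`, sine starlikeness. -/
def phiSin (z : ℂ) : ℂ := 1 + Complex.sin z

/-- `φ z = z + √(1 + z²)`, lune starlikeness. -/
def phiLune (z : ℂ) : ℂ := z + (1 + z ^ 2) ^ (1 / 2 : ℂ)

/-- `φ z = 1 + (z k + z²)/(k² - k z)` with `k = √2 + 1`. -/
def phiR (z : ℂ) : ℂ :=
  1 + (z * ((√2 + 1 : ℝ) : ℂ) + z ^ 2) / (((√2 + 1 : ℝ) : ℂ) ^ 2 - ((√2 + 1 : ℝ) : ℂ) * z)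

/-- `φ z = 1 + (4/3) z + (2/3) z²`, cardioid starlikeness. -/
def phiC (z : ℂ) : ℂ := 1 + (4 / 3) * z + (2 / 3) * z ^ 2

/-- The normalized restriction of `f` to the disk of radius `r`, carried to the unit disk:
`z ↦ f (r z) / r`. It belongs to a class `𝒢` exactly when `f` has in `|z| < r` the property that
characterizes `𝒢`. -/
def dilate (r : ℝ) (f : ℂ → ℂ) (z : ℂ) : ℂ := f ((r : ℂ) * z) / (r : ℂ)

/-- The numbers `R ∈ [0, 1]` such that every function in `F` has the property defining `G` in each
disk of radius `r`, `0 < r < R`. -/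
def admissible (G F : Set (ℂ → ℂ)) : Set ℝ :=
  {R | 0 ≤ R ∧ R ≤ 1 ∧ ∀ r : ℝ, 0 < r → r < R → ∀ f ∈ F, dilate r f ∈ G}

/-- The `G` radius of `F`: the largest admissible number (see `isGreatest_radius`). -/
def radius (G F : Set (ℂ → ℂ)) : ℝ := sSup (admissible G F)

/-- The supremum in the definition of the radius is always attained. -/
theorem isGreatest_radius (G F : Set (ℂ → ℂ)) : IsGreatest (admissible G F) (radius G F) := by
  have h0 : (0 : ℝ) ∈ admissible G F :=
    ⟨le_refl _, zero_le_one, fun r h1 h2 => absurd h2 (not_lt.mpr h1.le)⟩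
  have hb : BddAbove (admissible G F) := ⟨1, fun R hR => hR.2.1⟩
  refine ⟨⟨le_csSup hb h0, csSup_le ⟨0, h0⟩ fun R hR => hR.2.1, ?_⟩, fun R hR => le_csSup hb hR⟩
  intro r hr hrR f hf
  obtain ⟨R, hR, hlt⟩ := exists_lt_of_lt_csSup ⟨0, h0⟩ hrR
  exact hR.2.2 r hr hlt f hf

/-- The class `ℱ₂` of `f ∈ 𝒜` such that `|f/g - 1| < 1` and `Re (g/(z + z²/2)) > 0` for some
`g ∈ 𝒜`. At the origin both quotients have the removable value `1`, so only `z ≠ 0` matters. -/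
def classF2 : Set (ℂ → ℂ) :=
  {f | f ∈ classA ∧ ∃ g ∈ classA, ∀ z ∈ unitDisk, z ≠ 0 →
    ‖f z / g z - 1‖ < 1 ∧ 0 < (g z / (z + z ^ 2 / 2)).re}

/-- The function `f₂ z = (1 + z)² (z + z²/2) / (1 - z)`. -/
def f2 (z : ℂ) : ℂ := (1 + z) ^ 2 * (z + z ^ 2 / 2) / (1 - z)

/-- `f` shows that the `G` radius of `F` is sharp: `f` belongs to `F` and fails to have the property
defining `G` in every larger disk. -/
def IsExtremal (G F : Set (ℂ → ℂ)) (f : ℂ → ℂ) : Prop :=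
  f ∈ F ∧ ∀ r : ℝ, radius G F < r → r ≤ 1 → dilate r f ∉ G

end StarRadius

end

open StarRadius

open StarRadius

namespace StarRadius

/-! Put h = f/g and p = g/(z + z²/2), so that f(z)/z = h·p·(1 + z/2). Logarithmic derivatives add,
and s_f − 1 = z(h'/h + p'/p + 1/(2 + z)). With r = |z|, Schwarz–Pick bounds the first two terms by
(1 + r)/(1 − r²) and 2/(1 − r²), and the third is at most 1/(2 − r). Hence |s_f − 1| ≤ D(r), where D
is `starDeviation` (`norm_starQuot_sub_one_le`). For f₂ all three bounds are attained at z = −r with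
the same sign, so s_{f₂}(−r) = 1 − D(r) (`starQuot_f2_neg`).

D increases strictly on [0, 1), and the cubic of (i) is a positive multiple of 1 − α − D(r) there,
so its smallest positive root ρ solves D(ρ) = 1 − α. Every class that contains all f with |s_f − 1|
< 1 − α and whose members never have s_f = α therefore has radius ρ (`radius_eq_of_starDisk`). For
𝒮*(α) this needs the univalence of starlike functions. For 𝒮*(φ), α is the boundary value φ(−1): one
shows that φ omits α on 𝔻 and that φ has an analytic right inverse, with values in 𝔻, on the disk of
radius 1 − α about 1 (`radius_starlikeSub`). -/

lemma mem_unitDisk {z : ℂ} : z ∈ unitDisk ↔ ‖z‖ < 1 := by simp [unitDisk]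

lemma isOpen_unitDisk : IsOpen unitDisk := isOpen_ball

lemma zero_mem_unitDisk : (0 : ℂ) ∈ unitDisk := by simp [unitDisk]

lemma unitDisk_mem_nhds {z : ℂ} (hz : z ∈ unitDisk) : unitDisk ∈ nhds z :=
  isOpen_unitDisk.mem_nhds hz

lemma starQuot_zero (f : ℂ → ℂ) : starQuot f 0 = 1 := by simp [starQuot]

lemma starQuot_of_ne {f : ℂ → ℂ} {z : ℂ} (hz : z ≠ 0) : starQuot f z = z * deriv f z / f z := by
  simp [starQuot, hz]

/-! ### The deviation function and the cubic -/

/-- The sharp bound for `‖s_f z - 1‖` on `‖z‖ ≤ r`, `f ∈ ℱ₂`. -/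
noncomputable def starDeviation (r : ℝ) : ℝ := r / (2 - r) + r * (3 + r) / (1 - r ^ 2)

lemma starDeviation_strictMonoOn : StrictMonoOn starDeviation (Ico 0 1) := by
  rintro r ⟨hr0, hr1⟩ s ⟨hs0, hs1⟩ hrs
  have h1 : r / (2 - r) < s / (2 - s) := by
    rw [div_lt_div_iff₀ (by linarith) (by linarith)]; nlinarith
  have h2 : r * (3 + r) / (1 - r ^ 2) ≤ s * (3 + s) / (1 - s ^ 2) := by
    apply div_le_div₀ (by positivity) (by nlinarith) (by nlinarith) (by nlinarith)
  exact add_lt_add_of_lt_of_le h1 h2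

lemma cubic_eq {α r : ℝ} (h0 : 0 ≤ r) (h1 : r < 1) :
    (3 - α) * r ^ 3 + (2 * α - 1) * r ^ 2 - (8 - α) * r + 2 - 2 * α =
      (2 - r) * (1 - r ^ 2) * (1 - α - starDeviation r) := by
  have h2 : (2 - r) ≠ 0 := by linarith
  have h3 : (1 - r ^ 2) ≠ 0 := by nlinarith
  unfold starDeviation
  field_simp
  ring

lemma cubic_eq_zero_iff {α r : ℝ} (h0 : 0 ≤ r) (h1 : r < 1) :
    (3 - α) * r ^ 3 + (2 * α - 1) * r ^ 2 - (8 - α) * r + 2 - 2 * α = 0 ↔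
      starDeviation r = 1 - α := by
  have h2 : (2 - r) ≠ 0 := by linarith
  have h3 : (1 - r ^ 2) ≠ 0 := by nlinarith
  rw [cubic_eq h0 h1, mul_eq_zero, or_iff_right (mul_ne_zero h2 h3), sub_eq_zero, eq_comm]

lemma exists_starDeviation_eq {α : ℝ} (hα : α < 1) :
    ∃ ρ : ℝ, 0 < ρ ∧ ρ < 1 ∧ starDeviation ρ = 1 - α := by
  -- The cubic stands in for `starDeviation`, which blows up at 1; it runs from 2 − 2α > 0 at 0 to
  -- −4 at 1.
  have hc : ContinuousOn (fun r : ℝ =>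
      (3 - α) * r ^ 3 + (2 * α - 1) * r ^ 2 - (8 - α) * r + 2 - 2 * α) (Icc 0 1) := by fun_prop
  obtain ⟨ρ, ⟨hρ0, hρ1⟩, hρ⟩ := intermediate_value_Ioo' zero_le_one hc
    (show (0 : ℝ) ∈ Ioo _ _ from ⟨by norm_num; linarith, by norm_num; linarith⟩)
  exact ⟨ρ, hρ0, hρ1, (cubic_eq_zero_iff hρ0.le hρ1).1 hρ⟩

lemma isLeast_cubic_root {α ρ : ℝ} (h0 : 0 < ρ) (h1 : ρ < 1) (h : starDeviation ρ = 1 - α) :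
    IsLeast {r : ℝ | 0 < r ∧
      (3 - α) * r ^ 3 + (2 * α - 1) * r ^ 2 - (8 - α) * r + 2 - 2 * α = 0} ρ := by
  refine ⟨⟨h0, (cubic_eq_zero_iff h0.le h1).2 h⟩, ?_⟩
  rintro s ⟨hs0, hs⟩
  by_contra! hlt
  have := (cubic_eq_zero_iff hs0.le (hlt.trans h1)).1 hs
  exact absurd (this.trans h.symm)
    (starDeviation_strictMonoOn ⟨hs0.le, hlt.trans h1⟩ ⟨h0.le, h1⟩ hlt).ne

/-! ### Disk condition on s_f and dilations -/

/-- Functions in `𝒜` without zeros other than the origin whose quotient `s_f` stays within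
distance `c` of `1`. -/
def starDisk (c : ℝ) : Set (ℂ → ℂ) :=
  {f | f ∈ classA ∧ (∀ z ∈ unitDisk, z ≠ 0 → f z ≠ 0) ∧ ∀ z ∈ unitDisk, ‖starQuot f z - 1‖ < c}

lemma mul_mem_unitDisk {r : ℝ} (h0 : 0 ≤ r) (h1 : r ≤ 1) {z : ℂ} (hz : z ∈ unitDisk) :
    (r : ℂ) * z ∈ unitDisk := by
  rw [mem_unitDisk] at *
  rw [norm_mul, Complex.norm_real, Real.norm_of_nonneg h0]
  nlinarith [norm_nonneg z]

lemma deriv_dilate {r : ℝ} (hr : r ≠ 0) (f : ℂ → ℂ) (z : ℂ) :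
    deriv (dilate r f) z = deriv f (r * z) := by
  have : dilate r f = fun z => (fun w => f (r * w)) z / (r : ℂ) := rfl
  rw [this, deriv_div_const, deriv_comp_mul_left, smul_eq_mul]
  field_simp [Complex.ofReal_ne_zero.2 hr]

lemma starQuot_dilate {r : ℝ} (hr : r ≠ 0) (f : ℂ → ℂ) (z : ℂ) :
    starQuot (dilate r f) z = starQuot f (r * z) := by
  have hr' := Complex.ofReal_ne_zero.2 hr
  rcases eq_or_ne z 0 with rfl | hz
  · simp [starQuot_zero]
  · rw [starQuot_of_ne hz, starQuot_of_ne (mul_ne_zero hr' hz), deriv_dilate hr, dilate,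
      div_div_eq_mul_div]
    congr 1; ring

lemma dilate_mem_classA {r : ℝ} (h0 : 0 < r) (h1 : r ≤ 1) {f : ℂ → ℂ} (hf : f ∈ classA) :
    dilate r f ∈ classA := by
  refine ⟨?_, by simp [dilate, hf.2.1], by rw [deriv_dilate h0.ne', mul_zero, hf.2.2]⟩
  refine DifferentiableOn.div_const ?_ _
  exact hf.1.comp (by fun_prop) fun z hz => mul_mem_unitDisk h0.le h1 hz

/-! ### Schwarz–Pick and bounds for logarithmic derivatives -/

lemma norm_one_sub_conj_mul_sq_sub (a b : ℂ) :
    ‖1 - (starRingEnd ℂ) a * b‖ ^ 2 - ‖b - a‖ ^ 2 = (1 - ‖a‖ ^ 2) * (1 - ‖b‖ ^ 2) := by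
  simp only [← Complex.normSq_eq_norm_sq, Complex.normSq_apply]
  simp
  ring

lemma one_sub_conj_mul_ne_zero {a b : ℂ} (ha : a ∈ unitDisk) (hb : b ∈ unitDisk) :
    1 - (starRingEnd ℂ) a * b ≠ 0 := by
  rw [mem_unitDisk] at ha hb
  intro h
  have h2 : (starRingEnd ℂ) a * b = 1 := (sub_eq_zero.1 h).symm
  have h3 := congrArg norm h2
  rw [norm_mul, RCLike.norm_conj, norm_one] at h3
  nlinarith [norm_nonneg a, norm_nonneg b]

/-- The automorphism of the unit disk that carries `a` to the origin. -/
noncomputable def diskAut (a z : ℂ) : ℂ := (z - a) / (1 - (starRingEnd ℂ) a * z)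

lemma diskAut_mem {a z : ℂ} (ha : a ∈ unitDisk) (hz : z ∈ unitDisk) : diskAut a z ∈ unitDisk := by
  have h0 := one_sub_conj_mul_ne_zero ha hz
  have h := norm_one_sub_conj_mul_sq_sub a z
  rw [mem_unitDisk] at *
  rw [diskAut, norm_div, div_lt_one (norm_pos_iff.2 h0)]
  have h1 : 0 < (1 - ‖a‖ ^ 2) * (1 - ‖z‖ ^ 2) := by
    apply mul_pos <;> nlinarith [norm_nonneg a, norm_nonneg z]
  exact lt_of_pow_lt_pow_left₀ 2 (norm_nonneg _) (by linarith)

lemma hasDerivAt_diskAut {a z : ℂ} (ha : a ∈ unitDisk) (hz : z ∈ unitDisk) :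
    HasDerivAt (diskAut a) ((1 - ‖a‖ ^ 2) / (1 - (starRingEnd ℂ) a * z) ^ 2) z := by
  have h0 := one_sub_conj_mul_ne_zero ha hz
  have h1 : HasDerivAt (fun z => z - a) 1 z := (hasDerivAt_id z).sub_const a
  have h2 : HasDerivAt (fun z => 1 - (starRingEnd ℂ) a * z) (-((starRingEnd ℂ) a)) z := by
    simpa using ((hasDerivAt_id z).const_mul ((starRingEnd ℂ) a)).const_sub 1
  refine (h1.fun_div h2 h0).congr_deriv ?_
  rw [← Complex.conj_mul']
  congr 1
  ring

/-- The **Schwarz–Pick lemma**, infinitesimal form. -/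
theorem norm_deriv_le_of_mapsTo_unitDisk {w : ℂ → ℂ} (hd : DifferentiableOn ℂ w unitDisk)
    (hm : MapsTo w unitDisk unitDisk) {a : ℂ} (ha : a ∈ unitDisk) :
    ‖deriv w a‖ ≤ (1 - ‖w a‖ ^ 2) / (1 - ‖a‖ ^ 2) := by
  have ha' := mem_unitDisk.1 ha
  have hna : -a ∈ unitDisk := by simpa [mem_unitDisk] using ha
  have hwa := hm ha
  have hwa' := mem_unitDisk.1 hwa
  have hA : 0 < 1 - ‖a‖ ^ 2 := by nlinarith [norm_nonneg a]
  have hB : 0 < 1 - ‖w a‖ ^ 2 := by nlinarith [norm_nonneg (w a)]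
  -- Conjugating by disk automorphisms makes the map fix 0, where the Schwarz lemma bounds the
  -- derivative by 1.
  set g : ℂ → ℂ := fun z => diskAut (w a) (w (diskAut (-a) z)) with hg
  have hmap : MapsTo g unitDisk unitDisk := fun z hz => diskAut_mem hwa (hm (diskAut_mem hna hz))
  have hdg : DifferentiableOn ℂ g unitDisk := fun z hz => by
    have h1 := (hasDerivAt_diskAut hna hz).differentiableAt
    have h2 := hd.differentiableAt (unitDisk_mem_nhds (diskAut_mem hna hz))
    have h3 := (hasDerivAt_diskAut hwa (hm (diskAut_mem hna hz))).differentiableAt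
    exact (h3.comp z (h2.comp z h1)).differentiableWithinAt
  have e0 : diskAut (-a) 0 = a := by simp [diskAut]
  have hg0 : g 0 = 0 := by simp [hg, diskAut]
  have hderiv : HasDerivAt g ((1 - ‖w a‖ ^ 2) / (1 - (starRingEnd ℂ) (w a) * w a) ^ 2 *
      (deriv w a * ((1 - ‖a‖ ^ 2) / 1))) 0 := by
    have h1 := hasDerivAt_diskAut hna zero_mem_unitDisk
    have h2 : HasDerivAt w (deriv w a) (diskAut (-a) 0) := by
      rw [e0]; exact (hd.differentiableAt (unitDisk_mem_nhds ha)).hasDerivAt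
    have h3 : HasDerivAt (diskAut (w a))
        ((1 - ‖w a‖ ^ 2) / (1 - (starRingEnd ℂ) (w a) * w a) ^ 2) (w (diskAut (-a) 0)) := by
      rw [e0]; exact hasDerivAt_diskAut hwa hwa
    refine (h3.comp (0 : ℂ) (h2.comp (0 : ℂ) h1)).congr_deriv ?_
    simp
  have key := Complex.norm_deriv_le_one_of_mapsTo_ball (f := g) (c := 0) (R := 1) hdg
    (by rw [hg0]; exact fun z hz => ball_subset_closedBall (hmap hz)) one_pos
  rw [hderiv.deriv, Complex.conj_mul'] at key
  have e1 : ((1 : ℂ) - (‖w a‖ : ℂ) ^ 2) = ((1 - ‖w a‖ ^ 2 : ℝ) : ℂ) := by push_cast; rfl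
  have e2 : ((1 : ℂ) - (‖a‖ : ℂ) ^ 2) = ((1 - ‖a‖ ^ 2 : ℝ) : ℂ) := by push_cast; rfl
  rw [e1, e2, div_one, norm_mul, norm_mul, norm_div, norm_pow, Complex.norm_real, Complex.norm_real,
    Real.norm_of_nonneg hA.le, Real.norm_of_nonneg hB.le] at key
  rw [le_div_iff₀ hA]
  have : (1 - ‖w a‖ ^ 2) / (1 - ‖w a‖ ^ 2) ^ 2 * (‖deriv w a‖ * (1 - ‖a‖ ^ 2)) =
    ‖deriv w a‖ * (1 - ‖a‖ ^ 2) / (1 - ‖w a‖ ^ 2) := by field_simp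
  rwa [this, div_le_one hB] at key

/-- Schwarz–Pick for the Cayley transform (p − 1)/(p + 1) says |p'| ≤ 2 Re p/(1 − |z|²), and Re p ≤
|p|. -/
lemma norm_logDeriv_le_of_re_pos {p : ℂ → ℂ} (hd : DifferentiableOn ℂ p unitDisk)
    (hp : ∀ z ∈ unitDisk, 0 < (p z).re) {z : ℂ} (hz : z ∈ unitDisk) :
    ‖logDeriv p z‖ ≤ 2 / (1 - ‖z‖ ^ 2) := by
  have hz' := mem_unitDisk.1 hz
  have hZ : 0 < 1 - ‖z‖ ^ 2 := by nlinarith [norm_nonneg z]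
  have hne : ∀ z ∈ unitDisk, p z + 1 ≠ 0 := fun z hz h => by
    have := congrArg Complex.re h
    simp at this
    linarith [hp z hz]
  have hid : ∀ z, ‖p z + 1‖ ^ 2 - ‖p z - 1‖ ^ 2 = 4 * (p z).re := fun z => by
    simp only [← Complex.normSq_eq_norm_sq, Complex.normSq_apply]
    simp
    ring
  set w : ℂ → ℂ := fun z => (p z - 1) / (p z + 1) with hw
  have hwd : DifferentiableOn ℂ w unitDisk := (hd.sub_const 1).div (hd.add_const 1) hne
  have hwm : MapsTo w unitDisk unitDisk := fun z hz => by
    rw [mem_unitDisk, hw, norm_div, div_lt_one (norm_pos_iff.2 (hne z hz))]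
    exact lt_of_pow_lt_pow_left₀ 2 (norm_nonneg _) (by linarith [hid z, hp z hz])
  have hpd := (hd.differentiableAt (unitDisk_mem_nhds hz)).hasDerivAt
  have hwz : deriv w z = 2 * deriv p z / (p z + 1) ^ 2 := by
    rw [((hpd.sub_const 1).fun_div (hpd.add_const 1) (hne z hz)).deriv]
    congr 1; ring
  have key := norm_deriv_le_of_mapsTo_unitDisk hwd hwm hz
  have hN : 0 < ‖p z + 1‖ := norm_pos_iff.2 (hne z hz)
  have e : 1 - ‖w z‖ ^ 2 = 4 * (p z).re / ‖p z + 1‖ ^ 2 := by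
    rw [hw, norm_div, ← hid z]; field_simp
  rw [e, hwz, norm_div, norm_mul, norm_pow, Complex.norm_ofNat, div_div, mul_comm (‖p z + 1‖ ^ 2),
    ← div_div, div_le_div_iff_of_pos_right (by positivity), le_div_iff₀ hZ] at key
  have hpz : 0 < ‖p z‖ := (hp z hz).trans_le (Complex.re_le_norm _)
  rw [logDeriv_apply, norm_div, div_le_div_iff₀ hpz hZ]
  nlinarith [Complex.re_le_norm (p z)]

/-- For w = h − 1, Schwarz–Pick bounds |h'| by (1 − |w|²)/(1 − |z|²), while |h| ≥ 1 − |w|. The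
quotient leaves 1 + |w|, and |w| ≤ |z| by the Schwarz lemma. -/
lemma norm_logDeriv_le_of_norm_sub_one_lt {h : ℂ → ℂ} (hd : DifferentiableOn ℂ h unitDisk)
    (h0 : h 0 = 1) (hh : ∀ z ∈ unitDisk, ‖h z - 1‖ < 1) {z : ℂ} (hz : z ∈ unitDisk) :
    ‖logDeriv h z‖ ≤ (1 + ‖z‖) / (1 - ‖z‖ ^ 2) := by
  have hz' := mem_unitDisk.1 hz
  have hZ : 0 < 1 - ‖z‖ ^ 2 := by nlinarith [norm_nonneg z]
  set w : ℂ → ℂ := fun z => h z - 1 with hw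
  have hwd : DifferentiableOn ℂ w unitDisk := hd.sub_const 1
  have hwm : MapsTo w unitDisk unitDisk := fun z hz => mem_unitDisk.2 (hh z hz)
  have key := norm_deriv_le_of_mapsTo_unitDisk hwd hwm hz
  have hs : ‖w z‖ ≤ ‖z‖ := Complex.norm_le_norm_of_mapsTo_ball (R := 1) hwd
    (fun z hz => ball_subset_closedBall (hwm hz)) (by simp [hw, h0]) hz'
  have hlow : 1 - ‖w z‖ ≤ ‖h z‖ := by
    have := norm_sub_norm_le (1 : ℂ) (-w z)
    simpa only [norm_one, norm_neg, sub_neg_eq_add, hw, add_sub_cancel] using this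
  have hlt : ‖w z‖ < 1 := hh z hz
  have hpos : 0 < ‖h z‖ := by linarith
  have hwz : deriv w z = deriv h z := by rw [hw, deriv_sub_const_fun]
  rw [hwz, le_div_iff₀ hZ] at key
  rw [logDeriv_apply, norm_div, div_le_div_iff₀ hpos hZ]
  nlinarith [norm_nonneg (w z), norm_nonneg z]

/-! ### The sharp bound on ℱ₂ -/

lemma starQuot_eq_one_add {f u : ℂ → ℂ} {z : ℂ} (hz : z ∈ unitDisk)
    (hd : DifferentiableOn ℂ u unitDisk) (hu : u z ≠ 0) (hf : ∀ z, f z = z * u z) :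
    starQuot f z = 1 + z * logDeriv u z := by
  rcases eq_or_ne z 0 with rfl | h0
  · simp [starQuot_zero]
  have hfe : f = fun z => z * u z := funext hf
  have hd' := (hd.differentiableAt (unitDisk_mem_nhds hz)).hasDerivAt
  rw [starQuot_of_ne h0, hfe, ((hasDerivAt_id' z).fun_mul hd').deriv, logDeriv_apply]
  field_simp

/-- `dslope f 0` is f(z)/z with its removable singularity filled by f'(0). -/
lemma eq_mul_dslope {f : ℂ → ℂ} (h0 : f 0 = 0) (z : ℂ) : f z = z * dslope f 0 z := by
  have := sub_smul_dslope f 0 z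
  simpa [h0] using this.symm

lemma differentiableOn_dslope_zero {f : ℂ → ℂ} (hf : DifferentiableOn ℂ f unitDisk) :
    DifferentiableOn ℂ (dslope f 0) unitDisk :=
  (Complex.differentiableOn_dslope (unitDisk_mem_nhds zero_mem_unitDisk)).2 hf

lemma two_add_ne_zero {z : ℂ} (hz : z ∈ unitDisk) : 2 + z ≠ 0 := fun h => by
  have : z = -2 := by linear_combination h
  rw [mem_unitDisk, this] at hz
  norm_num at hz

theorem norm_starQuot_sub_one_le {f : ℂ → ℂ} (hf : f ∈ classF2) {z : ℂ} (hz : z ∈ unitDisk) :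
    ‖starQuot f z - 1‖ ≤ starDeviation ‖z‖ ∧ (z ≠ 0 → f z ≠ 0) := by
  obtain ⟨⟨hfd, hf0, hf1⟩, g, ⟨hgd, hg0, hg1⟩, H⟩ := hf
  have hz' := mem_unitDisk.1 hz
  set u := dslope f 0 with hu
  set v := dslope g 0 with hv
  have hfu : ∀ z, f z = z * u z := eq_mul_dslope hf0
  have hgv : ∀ z, g z = z * v z := eq_mul_dslope hg0
  have hu0 : u 0 = 1 := by rw [hu, dslope_same, hf1]
  have hv0 : v 0 = 1 := by rw [hv, dslope_same, hg1]
  have hud : DifferentiableOn ℂ u unitDisk := differentiableOn_dslope_zero hfd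
  have hvd : DifferentiableOn ℂ v unitDisk := differentiableOn_dslope_zero hgd
  set p : ℂ → ℂ := fun z => v z / (1 + z / 2) with hp
  set h : ℂ → ℂ := fun z => u z / v z with hh
  have hl : ∀ z ∈ unitDisk, 1 + z / 2 ≠ 0 := fun z hz h => by
    apply two_add_ne_zero hz
    linear_combination 2 * h
  have hlin : DifferentiableOn ℂ (fun z : ℂ => 1 + z / 2) unitDisk := by fun_prop
  have hpre : ∀ z ∈ unitDisk, 0 < (p z).re := fun z hz => by
    rcases eq_or_ne z 0 with rfl | h0
    · simp [hp, hv0]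
    · have := (H z hz h0).2
      rwa [hgv, show z + z ^ 2 / 2 = z * (1 + z / 2) by ring, mul_div_mul_left _ _ h0] at this
  have hhn : ∀ z ∈ unitDisk, ‖h z - 1‖ < 1 := fun z hz => by
    rcases eq_or_ne z 0 with rfl | h0
    · simp [hh, hv0, hu0]
    · have := (H z hz h0).1
      rwa [hgv, hfu, mul_div_mul_left _ _ h0] at this
  have hpne : ∀ z ∈ unitDisk, p z ≠ 0 := fun z hz h => by
    have := hpre z hz
    simp [h] at this
  have hvne : ∀ z ∈ unitDisk, v z ≠ 0 := fun z hz h => hpne z hz (by simp [hp, h])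
  have hhne : ∀ z ∈ unitDisk, h z ≠ 0 := fun z hz h => by
    have := hhn z hz
    simp [h] at this
  have hune : ∀ z ∈ unitDisk, u z ≠ 0 := fun z hz h => hhne z hz (by simp [hh, h])
  have hpd : DifferentiableOn ℂ p unitDisk := hvd.div hlin hl
  have hhd : DifferentiableOn ℂ h unitDisk := hud.div hvd hvne
  refine ⟨?_, fun h0 => by rw [hfu]; exact mul_ne_zero h0 (hune z hz)⟩
  have hnh := unitDisk_mem_nhds hz
  have hlog : logDeriv u z = logDeriv h z + logDeriv p z + 1 / (2 + z) := by
    have e1 : logDeriv h z = logDeriv u z - logDeriv v z :=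
      logDeriv_div z (hune z hz) (hvne z hz) (hud.differentiableAt hnh) (hvd.differentiableAt hnh)
    have e2 : logDeriv p z = logDeriv v z - logDeriv (fun z => 1 + z / 2) z :=
      logDeriv_div z (hvne z hz) (hl z hz) (hvd.differentiableAt hnh) (hlin.differentiableAt hnh)
    have e3 : logDeriv (fun z : ℂ => 1 + z / 2) z = 1 / (2 + z) := by
      have hd : HasDerivAt (fun z : ℂ => 1 + z / 2) (1 / 2) z :=
        ((hasDerivAt_id' z).div_const 2).const_add 1
      have h1 := hl z hz
      have h2 := two_add_ne_zero hz
      rw [logDeriv_apply, hd.deriv]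
      field_simp
    rw [e1, e2, e3]; ring
  rw [starQuot_eq_one_add hz hud (hune z hz) hfu, add_sub_cancel_left, hlog, norm_mul]
  have b1 := norm_logDeriv_le_of_norm_sub_one_lt hhd (by simp [hh, hu0, hv0]) hhn hz
  have b2 := norm_logDeriv_le_of_re_pos hpd hpre hz
  have b3 : ‖1 / (2 + z)‖ ≤ 1 / (2 - ‖z‖) := by
    rw [norm_div, norm_one]
    apply one_div_le_one_div_of_le (by linarith)
    have := norm_sub_norm_le (2 : ℂ) (-z)
    simpa using this
  have hZ : (1 - ‖z‖ ^ 2) ≠ 0 := by nlinarith [norm_nonneg z]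
  calc ‖z‖ * ‖logDeriv h z + logDeriv p z + 1 / (2 + z)‖
      ≤ ‖z‖ * ((1 + ‖z‖) / (1 - ‖z‖ ^ 2) + 2 / (1 - ‖z‖ ^ 2) + 1 / (2 - ‖z‖)) := by
        gcongr
        exact norm_add₃_le.trans (by gcongr)
    _ = starDeviation ‖z‖ := by unfold starDeviation; ring

/-! ### The extremal function -/

lemma f2_mem_classF2 : f2 ∈ classF2 := by
  have h1 : ∀ z ∈ unitDisk, 1 - z ≠ 0 := fun z hz h => by
    have : z = 1 := by linear_combination -h
    rw [mem_unitDisk, this] at hz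
    norm_num at hz
  have h2 : ∀ z ∈ unitDisk, 1 + z ≠ 0 := fun z hz h => by
    have : z = -1 := by linear_combination h
    rw [mem_unitDisk, this] at hz
    norm_num at hz
  -- The exponent 2 gives f₂ and the exponent 1 its companion g: then f₂/g = 1 + z and g/(z + z²/2)
  -- = (1 + z)/(1 − z).
  have hlim : ∀ n : ℕ, (fun z : ℂ => (1 + z) ^ n * (z + z ^ 2 / 2) / (1 - z)) ∈ classA := fun n => by
    refine ⟨DifferentiableOn.div (by fun_prop) (by fun_prop) h1, by simp, ?_⟩
    have e : (fun z : ℂ => (1 + z) ^ n * (z + z ^ 2 / 2) / (1 - z)) =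
        fun z => z * ((1 + z) ^ n * (1 + z / 2) / (1 - z)) := by ext z; ring
    have hd : DifferentiableAt ℂ (fun z : ℂ => (1 + z) ^ n * (1 + z / 2) / (1 - z)) 0 :=
      DifferentiableAt.div (by fun_prop) (by fun_prop) (by simp)
    rw [e, ((hasDerivAt_id' (0 : ℂ)).fun_mul hd.hasDerivAt).deriv]
    simp
  refine ⟨hlim 2, _, hlim 1, fun z hz h0 => ?_⟩
  have h3 : z + z ^ 2 / 2 ≠ 0 := by
    rw [show z + z ^ 2 / 2 = z * (2 + z) / 2 by ring]
    exact div_ne_zero (mul_ne_zero h0 (two_add_ne_zero hz)) two_ne_zero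
  have h1' := h1 z hz
  have h2' := h2 z hz
  have e1 : f2 z / ((1 + z) ^ 1 * (z + z ^ 2 / 2) / (1 - z)) = 1 + z := by
    rw [f2, div_div_div_cancel_right₀ h1', mul_div_mul_right _ _ h3]
    field_simp
  have e2 : (1 + z) ^ 1 * (z + z ^ 2 / 2) / (1 - z) / (z + z ^ 2 / 2) = (1 + z) / (1 - z) := by
    rw [div_right_comm, mul_div_cancel_right₀ _ h3, pow_one]
  rw [mem_unitDisk] at hz
  refine ⟨by rw [e1]; simpa using hz, ?_⟩
  rw [e2, Complex.div_re, ← add_div]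
  apply div_pos _ (Complex.normSq_pos.2 h1')
  have : ‖z‖ ^ 2 < 1 := by nlinarith [norm_nonneg z]
  rw [← Complex.normSq_eq_norm_sq, Complex.normSq_apply] at this
  simp
  nlinarith

lemma starQuot_f2_neg {r : ℝ} (h0 : 0 < r) (h1 : r < 1) :
    starQuot f2 (-(r : ℂ)) = ((1 - starDeviation r : ℝ) : ℂ) := by
  have hr : (r : ℂ) ≠ 0 := Complex.ofReal_ne_zero.2 h0.ne'
  have hp : (1 : ℂ) + r ≠ 0 := by exact_mod_cast (by linarith : (1 : ℝ) + r ≠ 0)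
  have hm : (1 : ℂ) - r ≠ 0 := by exact_mod_cast (by linarith : (1 : ℝ) - r ≠ 0)
  have h2 : (2 : ℂ) - r ≠ 0 := by exact_mod_cast (by linarith : (2 : ℝ) - r ≠ 0)
  have hq : (1 : ℂ) - r ^ 2 ≠ 0 := by
    rw [show (1 : ℂ) - r ^ 2 = (1 - r) * (1 + r) by ring]; exact mul_ne_zero hm hp
  have hd1 : HasDerivAt (fun z : ℂ => 1 + z) 1 (-(r : ℂ)) := (hasDerivAt_id' _).const_add 1
  have hd2 : HasDerivAt (fun z : ℂ => 1 - z) (-1) (-(r : ℂ)) := (hasDerivAt_id' _).const_sub 1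
  have hd3 : HasDerivAt (fun z : ℂ => z + z ^ 2 / 2) _ (-(r : ℂ)) :=
    (hasDerivAt_id' _).fun_add ((hasDerivAt_pow 2 (-(r : ℂ))).div_const 2)
  have hd : HasDerivAt f2 _ (-(r : ℂ)) :=
    ((hd1.fun_pow 2).fun_mul hd3).fun_div hd2 (by simpa using hp)
  rw [starQuot_of_ne (neg_ne_zero.2 hr), hd.deriv, f2, starDeviation]
  push_cast
  have e1 : -(r : ℂ) + (-(r : ℂ)) ^ 2 / 2 = -r * (2 - r) / 2 := by ring
  rw [e1, sub_neg_eq_add, ← sub_eq_add_neg]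
  rw [show (1 : ℂ) - r ^ 2 = (1 - r) * (1 + r) by ring]
  field_simp
  ring

/-! ### From disks to radii -/

theorem radius_eq_of_starDisk {G : Set (ℂ → ℂ)} {α ρ : ℝ} (hG : starDisk (1 - α) ⊆ G)
    (hα : ∀ f ∈ G, ∀ z ∈ unitDisk, starQuot f z ≠ α) (h0 : 0 < ρ) (h1 : ρ < 1)
    (hρ : starDeviation ρ = 1 - α) : radius G classF2 = ρ ∧ IsExtremal G classF2 f2 := by
  have hnot : ∀ r : ℝ, ρ < r → r ≤ 1 → dilate r f2 ∉ G := fun r hr hr1 hmem => by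
    have hr0 := h0.trans hr
    -- The dilation carries this point to −ρ, where s_{f₂} equals α.
    refine hα _ hmem (-((ρ / r : ℝ) : ℂ)) ?_ ?_
    · rw [mem_unitDisk, norm_neg, Complex.norm_real, Real.norm_of_nonneg (by positivity),
        div_lt_one hr0]
      exact hr
    · rw [starQuot_dilate hr0.ne', mul_neg, ← Complex.ofReal_mul, mul_div_cancel₀ _ hr0.ne',
        starQuot_f2_neg h0 h1, hρ, sub_sub_cancel]
  have hgreat : IsGreatest (admissible G classF2) ρ := by
    refine ⟨⟨h0.le, h1.le, fun r hr hrρ f hf => hG ?_⟩, fun R hR => ?_⟩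
    · have hr1 := hrρ.trans h1
      refine ⟨dilate_mem_classA hr hr1.le hf.1, fun z hz hz0 => ?_, fun z hz => ?_⟩
      · exact div_ne_zero ((norm_starQuot_sub_one_le hf (mul_mem_unitDisk hr.le hr1.le hz)).2
          (mul_ne_zero (Complex.ofReal_ne_zero.2 hr.ne') hz0)) (Complex.ofReal_ne_zero.2 hr.ne')
      · rw [starQuot_dilate hr.ne', ← hρ]
        refine (norm_starQuot_sub_one_le hf (mul_mem_unitDisk hr.le hr1.le hz)).1.trans_lt ?_
        have hn : ‖(r : ℂ) * z‖ < ρ := by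
          rw [norm_mul, Complex.norm_real, Real.norm_of_nonneg hr.le]
          nlinarith [norm_nonneg z, mem_unitDisk.1 hz]
        exact starDeviation_strictMonoOn ⟨norm_nonneg _, hn.trans h1⟩ ⟨h0.le, h1⟩ hn
    · by_contra! hlt
      obtain ⟨r, hr1, hr2⟩ := exists_between hlt
      exact hnot r hr1 (hr2.le.trans hR.2.1) (hR.2.2 r (h0.trans hr1) hr2 f2 f2_mem_classF2)
  have e : radius G classF2 = ρ := (isGreatest_radius G classF2).unique hgreat
  exact ⟨e, f2_mem_classF2, fun r hr => hnot r (e ▸ hr)⟩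

/-! ### Univalence of starlike functions -/

/-- The **Noshiro–Warschawski theorem**. -/
theorem injOn_of_re_deriv_pos {F F' : ℂ → ℂ} {U : Set ℂ} (hU : Convex ℝ U)
    (hF : ∀ z ∈ U, HasDerivAt F (F' z) z) (hre : ∀ z ∈ U, 0 < (F' z).re) : InjOn F U := by
  intro a ha b hb hab
  by_contra hne
  have hba : b - a ≠ 0 := sub_ne_zero.2 (Ne.symm hne)
  have hmem : ∀ t ∈ Icc (0 : ℝ) 1, a + t * (b - a) ∈ U := fun t ht => by
    simpa using hU.add_smul_sub_mem ha hb ht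
  -- On the segment from a to b, Re(F/(b − a)) has derivative Re F' > 0, so its endpoint values
  -- differ.
  have hd : ∀ t ∈ Icc (0 : ℝ) 1, HasDerivAt
      (fun t : ℝ => (F (a + t * (b - a)) / (b - a)).re) (F' (a + t * (b - a))).re t := by
    intro t ht
    have h1 : HasDerivAt (fun t : ℂ => a + t * (b - a)) (b - a) (t : ℂ) := by
      simpa using ((hasDerivAt_id' (t : ℂ)).mul_const (b - a)).const_add a
    have h2 := (((hF _ (hmem t ht)).comp (t : ℂ) h1).div_const (b - a)).real_of_complex
    simpa [mul_div_assoc, hba] using h2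
  have hmono := strictMonoOn_of_deriv_pos (convex_Icc (0 : ℝ) 1)
    (fun t ht => (hd t ht).continuousAt.continuousWithinAt) (fun t ht => by
      have ht' := interior_subset ht
      rw [(hd t ht').deriv]
      exact hre _ (hmem t ht'))
  have := hmono (left_mem_Icc.2 zero_le_one) (right_mem_Icc.2 zero_le_one) one_pos
  simp [hab] at this

lemma dslope_ne_zero {f : ℂ → ℂ} (hf : f ∈ classA) (hne : ∀ z ∈ unitDisk, z ≠ 0 → f z ≠ 0)
    {z : ℂ} (hz : z ∈ unitDisk) : dslope f 0 z ≠ 0 := by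
  rcases eq_or_ne z 0 with rfl | h0
  · rw [dslope_same, hf.2.2]; exact one_ne_zero
  · intro h
    apply hne z hz h0
    rw [eq_mul_dslope hf.2.1, h, mul_zero]

lemma starQuot_eq_one_add_dslope {f : ℂ → ℂ} (hf : f ∈ classA)
    (hne : ∀ z ∈ unitDisk, z ≠ 0 → f z ≠ 0) {z : ℂ} (hz : z ∈ unitDisk) :
    starQuot f z = 1 + z * logDeriv (dslope f 0) z :=
  starQuot_eq_one_add hz (differentiableOn_dslope_zero hf.1) (dslope_ne_zero hf hne hz)
    (eq_mul_dslope hf.2.1)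

lemma differentiableOn_logDeriv_dslope {f : ℂ → ℂ} (hf : f ∈ classA)
    (hne : ∀ z ∈ unitDisk, z ≠ 0 → f z ≠ 0) :
    DifferentiableOn ℂ (logDeriv (dslope f 0)) unitDisk :=
  ((differentiableOn_dslope_zero hf.1).deriv isOpen_unitDisk).div
    (differentiableOn_dslope_zero hf.1) fun _ hz => dslope_ne_zero hf hne hz

lemma differentiableOn_starQuot {f : ℂ → ℂ} (hf : f ∈ classA)
    (hne : ∀ z ∈ unitDisk, z ≠ 0 → f z ≠ 0) : DifferentiableOn ℂ (starQuot f) unitDisk := by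
  refine DifferentiableOn.congr (f := fun z => 1 + z * logDeriv (dslope f 0) z) ?_
    fun z hz => starQuot_eq_one_add_dslope hf hne hz
  exact (differentiableOn_id.mul (differentiableOn_logDeriv_dslope hf hne)).const_add 1

/-- Starlike functions are univalent. -/
theorem injOn_of_re_starQuot_pos {f : ℂ → ℂ} (hf : f ∈ classA)
    (hne : ∀ z ∈ unitDisk, z ≠ 0 → f z ≠ 0) (hre : ∀ z ∈ unitDisk, 0 < (starQuot f z).re) :
    InjOn f unitDisk := by
  set u := dslope f 0 with hu
  have hud : DifferentiableOn ℂ u unitDisk := differentiableOn_dslope_zero hf.1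
  have hune : ∀ z ∈ unitDisk, u z ≠ 0 := fun z hz => dslope_ne_zero hf hne hz
  -- A primitive q of the logarithmic derivative of f(z)/z with q(0) = 0 yields f(z) = z·exp(q(z)).
  obtain ⟨q, hq0, hq⟩ :=
    (differentiableOn_logDeriv_dslope hf hne).isExactOn_ball.with_val_at 0 0
  have hexp : ∀ z ∈ unitDisk, f z = z * Complex.exp (q z) := by
    have hd : ∀ z ∈ unitDisk, HasDerivAt (fun z => u z * Complex.exp (-q z)) 0 z := by
      intro z hz
      refine ((hud.differentiableAt (unitDisk_mem_nhds hz)).hasDerivAt.fun_mul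
        (hq z hz).fun_neg.cexp).congr_deriv ?_
      have := hune z hz
      rw [← hu, logDeriv_apply]
      field_simp
      ring
    intro z hz
    have hc : u z * Complex.exp (-q z) = u 0 * Complex.exp (-q 0) :=
      isOpen_unitDisk.is_const_of_deriv_eq_zero (convex_ball (0 : ℂ) 1).isPreconnected
        (fun z hz => (hd z hz).differentiableAt.differentiableWithinAt)
        (fun z hz => (hd z hz).deriv) hz zero_mem_unitDisk
    rw [hq0, hu, dslope_same, hf.2.2, ← hu, neg_zero, Complex.exp_zero, mul_one,
      Complex.exp_neg, ← div_eq_mul_inv, div_eq_one_iff_eq (Complex.exp_ne_zero _)] at hc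
    rw [eq_mul_dslope hf.2.1, ← hu, hc]
  have hmem : ∀ ζ : ℂ, ζ.re < 0 → Complex.exp ζ ∈ unitDisk := fun ζ hζ => by
    rw [mem_unitDisk, Complex.norm_exp]; simpa using hζ
  -- F is a logarithm of f(e^ζ) on the left half-plane. Its derivative s_f(e^ζ) has positive real
  -- part and the domain is convex, so F is injective.
  set F : ℂ → ℂ := fun ζ => ζ + q (Complex.exp ζ) with hF
  have hFd : ∀ ζ ∈ {ζ : ℂ | ζ.re < 0}, HasDerivAt F (starQuot f (Complex.exp ζ)) ζ := by
    intro ζ hζ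
    refine ((hasDerivAt_id' ζ).fun_add
      ((hq _ (hmem ζ hζ)).comp ζ (Complex.hasDerivAt_exp ζ))).congr_deriv ?_
    rw [starQuot_eq_one_add_dslope hf hne (hmem ζ hζ), mul_comm]
  have hFi : InjOn F {ζ : ℂ | ζ.re < 0} :=
    injOn_of_re_deriv_pos (convex_halfSpace_re_lt 0) hFd fun ζ hζ => hre _ (hmem ζ hζ)
  have hFexp : ∀ ζ : ℂ, ζ.re < 0 → Complex.exp (F ζ) = f (Complex.exp ζ) := fun ζ hζ => by
    rw [hF, Complex.exp_add, hexp _ (hmem ζ hζ)]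
  have hlog : ∀ z ∈ unitDisk, z ≠ 0 → (Complex.log z).re < 0 := fun z hz h0 => by
    rw [Complex.log_re]; exact Real.log_neg (norm_pos_iff.2 h0) (mem_unitDisk.1 hz)
  intro a ha b hb hab
  rcases eq_or_ne a 0 with rfl | ha0
  · by_contra h
    exact hne b hb (Ne.symm h) (hab ▸ hf.2.1)
  rcases eq_or_ne b 0 with rfl | hb0
  · exact absurd (hab.trans hf.2.1) (hne a ha ha0)
  have hE : Complex.exp (F (Complex.log a)) = Complex.exp (F (Complex.log b)) := by
    rw [hFexp _ (hlog a ha ha0), hFexp _ (hlog b hb hb0), Complex.exp_log ha0, Complex.exp_log hb0,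
      hab]
  obtain ⟨n, hn⟩ := Complex.exp_eq_exp_iff_exists_int.1 hE
  have hper : Complex.exp (Complex.log b + n * (2 * Real.pi * Complex.I)) = b := by
    rw [Complex.exp_add, Complex.exp_int_mul_two_pi_mul_I, mul_one, Complex.exp_log hb0]
  -- F commutes with translation by 2πi, so the ambiguity of the logarithm is absorbed into the
  -- argument.
  have hFb : F (Complex.log a) = F (Complex.log b + n * (2 * Real.pi * Complex.I)) := by
    rw [hn]
    simp only [hF, hper, Complex.exp_log hb0]
    ring
  have := hFi (hlog a ha ha0) (by simpa using hlog b hb hb0) hFb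
  rw [← Complex.exp_log ha0, this, hper]

lemma starDisk_subset_starlikeOrder {α : ℝ} (h0 : 0 ≤ α) :
    starDisk (1 - α) ⊆ starlikeOrder α := by
  rintro f ⟨hf, hne, hs⟩
  have hre : ∀ z ∈ unitDisk, α < (starQuot f z).re := fun z hz => by
    have h1 := (abs_le.1 (Complex.abs_re_le_norm (starQuot f z - 1))).1
    have h2 := hs z hz
    rw [Complex.sub_re, Complex.one_re] at h1
    linarith
  exact ⟨⟨hf, injOn_of_re_starQuot_pos hf hne fun z hz => h0.trans_lt (hre z hz)⟩, hre⟩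

lemma starQuot_ne_of_mem_starlikeOrder {α : ℝ} :
    ∀ f ∈ starlikeOrder α, ∀ z ∈ unitDisk, starQuot f z ≠ α := fun f hf z hz h => by
  have := hf.2 z hz
  rw [h, Complex.ofReal_re] at this
  exact lt_irrefl _ this

theorem radius_starlikeOrder {α ρ : ℝ} (hα : 0 ≤ α) (h0 : 0 < ρ) (h1 : ρ < 1)
    (hρ : starDeviation ρ = 1 - α) :
    radius (starlikeOrder α) classF2 = ρ ∧ IsExtremal (starlikeOrder α) classF2 f2 :=
  radius_eq_of_starDisk (starDisk_subset_starlikeOrder hα) starQuot_ne_of_mem_starlikeOrder h0 h1 hρ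

/-! ### Subordination through a right inverse of φ -/

lemma starDisk_subset_starlikeSub {φ ψ : ℂ → ℂ} {c : ℝ} (hψ : DifferentiableOn ℂ ψ (ball 0 c))
    (hm : MapsTo ψ (ball 0 c) unitDisk) (h0 : ψ 0 = 0)
    (hφ : ∀ u ∈ ball (0 : ℂ) c, φ (ψ u) = 1 + u) : starDisk c ⊆ starlikeSub φ := by
  rintro f ⟨hf, hne, hs⟩
  have hball : MapsTo (fun z => starQuot f z - 1) unitDisk (ball 0 c) := fun z hz =>
    mem_ball_zero_iff.2 (hs z hz)
  refine ⟨hf, hne, fun z => ψ (starQuot f z - 1),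
    hψ.comp ((differentiableOn_starQuot hf hne).sub_const 1) hball, hm.comp hball,
    by simp [starQuot_zero, h0], fun z hz => ?_⟩
  rw [hφ _ (hball hz), add_sub_cancel]

/-- The radius of `𝒮*(φ)` over `ℱ₂` agrees with that of `𝒮*(α)` as soon as `φ` omits the value `α`
and has an analytic right inverse on the disk of radius `1 - α` about `1`. -/
theorem radius_starlikeSub {φ ψ : ℂ → ℂ} {α : ℝ} (hα : 0 ≤ α) (hα1 : α < 1)
    (hψ : DifferentiableOn ℂ ψ (ball 0 (1 - α))) (hm : MapsTo ψ (ball 0 (1 - α)) unitDisk)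
    (h0 : ψ 0 = 0) (hφ : ∀ u ∈ ball (0 : ℂ) (1 - α), φ (ψ u) = 1 + u)
    (hne : ∀ z ∈ unitDisk, φ z ≠ α) {x ε : ℝ} (hε : 0 < ε) (hlo : 0 ≤ x - ε)
    (hhi : x + ε < 1)
    (hx1 : starDeviation (x - ε) < 1 - α) (hx2 : 1 - α < starDeviation (x + ε)) :
    radius (starlikeSub φ) classF2 = radius (starlikeOrder α) classF2 ∧
      IsExtremal (starlikeSub φ) classF2 f2 ∧ |radius (starlikeSub φ) classF2 - x| < ε := by
  obtain ⟨ρ, hρ0, hρ1, hρ⟩ := exists_starDeviation_eq hα1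
  have key := radius_eq_of_starDisk (starDisk_subset_starlikeSub hψ hm h0 hφ)
    (fun f hf z hz => by
      obtain ⟨-, -, ω, -, hω, -, he⟩ := hf
      rw [he z hz]
      exact hne _ (hω hz)) hρ0 hρ1 hρ
  refine ⟨key.1.trans (radius_starlikeOrder hα hρ0 hρ1 hρ).1.symm, key.2, ?_⟩
  rw [key.1, abs_lt]
  -- Both bounds now compare values of `starDeviation`, so monotonicity places ρ between x − ε and x
  -- + ε.
  rw [← hρ] at hx1 hx2
  constructor
  · by_contra! h
    have := starDeviation_strictMonoOn.monotoneOn (a := ρ) (b := x - ε) ⟨hρ0.le, hρ1⟩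
      ⟨hlo, by linarith⟩ (by linarith)
    linarith
  · by_contra! h
    have := starDeviation_strictMonoOn.monotoneOn (a := x + ε) (b := ρ) ⟨by linarith, hhi⟩
      ⟨hρ0.le, hρ1⟩ (by linarith)
    linarith

/-! ### The principal square root and the slit plane -/

lemma cpow_half_sq (w : ℂ) : (w ^ (1 / 2 : ℂ)) ^ 2 = w := by
  rw [one_div]; exact Complex.cpow_ofNat_inv_pow w 2

lemma sq_cpow_half {x : ℂ} (hx : 0 < x.re) : (x ^ 2) ^ (1 / 2 : ℂ) = x := by
  rw [one_div]; exact Complex.sq_cpow_two_inv hx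

lemma re_cpow_half_pos {w : ℂ} (hw : w ∈ Complex.slitPlane) : 0 < (w ^ (1 / 2 : ℂ)).re := by
  have h0 := Complex.slitPlane_ne_zero hw
  rw [Complex.cpow_def_of_ne_zero h0, Complex.exp_re]
  have harg : |w.arg| < Real.pi :=
    lt_of_le_of_ne (Complex.abs_arg_le_pi w) fun h => by
      rcases (abs_eq Real.pi_pos.le).1 h with h | h
      · exact (Complex.mem_slitPlane_iff_arg.1 hw).1 h
      · exact (Complex.neg_pi_lt_arg w).ne' h
  rw [abs_lt] at harg
  have e : (Complex.log w * (1 / 2)).im = w.arg / 2 := by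
    rw [show (1 / 2 : ℂ) = ((1 / 2 : ℝ) : ℂ) by norm_num, Complex.im_mul_ofReal, Complex.log_im]
    ring
  rw [e]
  exact mul_pos (Real.exp_pos _) (Real.cos_pos_of_mem_Ioo ⟨by linarith, by linarith⟩)

/-- Two arguments in (−π/2, π/2) have their sum in (−π, π). -/
lemma mul_mem_slitPlane {a b : ℂ} (ha : 0 < a.re) (hb : 0 < b.re) : a * b ∈ Complex.slitPlane := by
  rw [Complex.mem_slitPlane_iff]
  by_contra! h
  obtain ⟨h1, h2⟩ := h
  simp only [Complex.mul_re, Complex.mul_im] at h1 h2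
  have h3 : a.re * (a.re * b.re - a.im * b.im) = a.re ^ 2 * b.re + a.im ^ 2 * b.re := by
    linear_combination -a.im * h2
  have h4 := mul_nonpos_of_nonneg_of_nonpos ha.le h1
  nlinarith [mul_pos (pow_pos ha 2) hb, mul_nonneg (sq_nonneg a.im) hb.le]

lemma re_abs_le_of_mem_ball {u : ℂ} {c : ℝ} (hu : u ∈ ball (0 : ℂ) c) : -c < u.re ∧ u.re < c := by
  rw [mem_ball_zero_iff] at hu
  exact abs_lt.1 ((Complex.abs_re_le_norm u).trans_lt hu)

lemma neg_one_notMem_unitDisk : (-1 : ℂ) ∉ unitDisk := by simp [mem_unitDisk]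

/-! ### The exponential function -/

/-- The Taylor series is dominated termwise by that of −log(1 − |u|). -/
lemma norm_log_one_add_le_neg_log {u : ℂ} (hu : ‖u‖ < 1) :
    ‖Complex.log (1 + u)‖ ≤ -Real.log (1 - ‖u‖) := by
  have h1 := Complex.hasSum_taylorSeries_neg_log (z := -u) (by simpa using hu)
  have h2 := (Complex.hasSum_taylorSeries_neg_log (z := (‖u‖ : ℂ)) (by simpa using hu)).mapL
    Complex.reCLM
  rw [sub_neg_eq_add] at h1
  have := h1.norm_le_of_bounded h2 fun n => by
    have : ((‖u‖ : ℂ) ^ n / n) = ((‖u‖ ^ n / n : ℝ) : ℂ) := by push_cast; rfl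
    simp only [this, Complex.reCLM_apply, Complex.ofReal_re]
    simp
  have e : (1 : ℂ) - (‖u‖ : ℂ) = ((1 - ‖u‖ : ℝ) : ℂ) := by push_cast; rfl
  rwa [norm_neg, e, Complex.reCLM_apply, Complex.neg_re, Complex.log_ofReal_re] at this

lemma differentiableOn_log_one_add {c : ℝ} (hc : c ≤ 1) :
    DifferentiableOn ℂ (fun u => Complex.log (1 + u)) (ball 0 c) := fun u hu => by
  refine DifferentiableAt.differentiableWithinAt (DifferentiableAt.clog (by fun_prop) ?_)
  left
  have := (re_abs_le_of_mem_ball hu).1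
  simp
  linarith

lemma mapsTo_log_one_add :
    MapsTo (fun u => Complex.log (1 + u)) (ball 0 (1 - 1 / Real.exp 1)) unitDisk := fun u hu => by
  rw [mem_ball_zero_iff] at hu
  have hp : 0 < 1 / Real.exp 1 := by positivity
  rw [mem_unitDisk]
  refine (norm_log_one_add_le_neg_log (by linarith)).trans_lt ?_
  have := Real.log_lt_log hp (show 1 / Real.exp 1 < 1 - ‖u‖ by linarith)
  rw [one_div, Real.log_inv, Real.log_exp] at this
  linarith

lemma phiE_log {u : ℂ} (hu : ‖u‖ < 1) : phiE (Complex.log (1 + u)) = 1 + u := by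
  refine Complex.exp_log fun h => ?_
  have : u = -1 := by linear_combination h
  simp [this] at hu

lemma phiE_ne {z : ℂ} (hz : z ∈ unitDisk) : phiE z ≠ ((1 / Real.exp 1 : ℝ) : ℂ) := fun h => by
  have h1 := congrArg norm h
  rw [phiE, Complex.norm_exp, Complex.norm_real, Real.norm_of_nonneg (by positivity), one_div,
    ← Real.exp_neg] at h1
  have h2 := Real.exp_injective h1
  have h3 := Complex.abs_re_le_norm z
  rw [h2] at h3
  rw [mem_unitDisk] at hz
  norm_num at h3
  linarith

/-! ### The sine function -/

/-- The principal branch of the inverse sine function. -/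
noncomputable def carcsin (u : ℂ) : ℂ :=
  -Complex.I * Complex.log (Complex.I * u + (1 - u ^ 2) ^ (1 / 2 : ℂ))

lemma one_sub_sq_mem_slitPlane {u : ℂ} (hu : ‖u‖ < 1) : 1 - u ^ 2 ∈ Complex.slitPlane := by
  left
  have h1 := Complex.re_le_norm (u ^ 2)
  rw [norm_pow] at h1
  rw [Complex.sub_re, Complex.one_re]
  nlinarith [norm_nonneg u]

/-- The two factors will be exp(±i arcsin u). -/
lemma I_mul_add_mul_sub (u : ℂ) :
    (Complex.I * u + (1 - u ^ 2) ^ (1 / 2 : ℂ)) * ((1 - u ^ 2) ^ (1 / 2 : ℂ) - Complex.I * u) = 1 := by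
  linear_combination cpow_half_sq (1 - u ^ 2) - u ^ 2 * Complex.I_sq

/-- If s = iu + q were real and ≤ 0, then s(2q − s) = 1 would have real part 2s·Re q − s² ≤ 0. -/
lemma I_mul_add_mem_slitPlane {u : ℂ} (hu : ‖u‖ < 1) :
    Complex.I * u + (1 - u ^ 2) ^ (1 / 2 : ℂ) ∈ Complex.slitPlane := by
  set q := (1 - u ^ 2) ^ (1 / 2 : ℂ) with hq
  have hre : 0 < q.re := re_cpow_half_pos (one_sub_sq_mem_slitPlane hu)
  have hm := I_mul_add_mul_sub u
  rw [← hq] at hm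
  rw [Complex.mem_slitPlane_iff]
  by_contra! h
  obtain ⟨h1, h2⟩ := h
  set s := Complex.I * u + q with hs
  have hs' : q - Complex.I * u = 2 * q - s := by rw [hs]; ring
  rw [hs'] at hm
  have h3 := congrArg Complex.re hm
  simp [h2] at h3
  nlinarith [sq_nonneg s.re, mul_nonneg (neg_nonneg.2 h1) hre.le]

lemma exp_I_mul_carcsin {u : ℂ} (hu : ‖u‖ < 1) :
    Complex.exp (carcsin u * Complex.I) = Complex.I * u + (1 - u ^ 2) ^ (1 / 2 : ℂ) := by
  rw [carcsin, show ∀ x : ℂ, -Complex.I * x * Complex.I = x from fun x => by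
    linear_combination -x * Complex.I_sq,
    Complex.exp_log (Complex.slitPlane_ne_zero (I_mul_add_mem_slitPlane hu))]

lemma exp_neg_I_mul_carcsin {u : ℂ} (hu : ‖u‖ < 1) :
    Complex.exp (-carcsin u * Complex.I) = (1 - u ^ 2) ^ (1 / 2 : ℂ) - Complex.I * u := by
  rw [neg_mul, Complex.exp_neg, exp_I_mul_carcsin hu]
  exact inv_eq_of_mul_eq_one_right (I_mul_add_mul_sub u)

lemma sin_carcsin {u : ℂ} (hu : ‖u‖ < 1) : Complex.sin (carcsin u) = u := by
  rw [Complex.sin, exp_I_mul_carcsin hu, exp_neg_I_mul_carcsin hu]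
  linear_combination -u * Complex.I_sq

lemma cos_carcsin {u : ℂ} (hu : ‖u‖ < 1) :
    Complex.cos (carcsin u) = (1 - u ^ 2) ^ (1 / 2 : ℂ) := by
  rw [Complex.cos, exp_I_mul_carcsin hu, exp_neg_I_mul_carcsin hu]
  ring

/-- The real part x is an argument, so |x| ≤ π. Moreover cos(arcsin u) is a principal root with
positive real part cos x·cosh y, so cos x > 0. -/
lemma abs_re_carcsin_lt {u : ℂ} (hu : ‖u‖ < 1) : |(carcsin u).re| < Real.pi / 2 := by
  set s := Complex.I * u + (1 - u ^ 2) ^ (1 / 2 : ℂ) with hs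
  have hre : (carcsin u).re = s.arg := by
    rw [carcsin, ← hs, ← Complex.log_im]; simp
  have hle := Complex.abs_arg_le_pi s
  have hc : 0 < (Complex.cos (carcsin u)).re := by
    rw [cos_carcsin hu]; exact re_cpow_half_pos (one_sub_sq_mem_slitPlane hu)
  rw [Complex.cos_eq, Complex.sub_re] at hc
  have hc' : 0 < Real.cos (carcsin u).re * Real.cosh (carcsin u).im := by
    simpa [← Complex.ofReal_cos, ← Complex.ofReal_cosh, ← Complex.ofReal_sin,
      ← Complex.ofReal_sinh] using hc
  have hcos := pos_of_mul_pos_left hc' (Real.cosh_pos _).le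
  by_contra! h
  rw [← Real.cos_abs] at hcos
  rw [← hre] at hle
  exact absurd hcos (not_lt.2 (Real.cos_nonpos_of_pi_div_two_le_of_le h (by linarith)))

lemma norm_sin_sq (z : ℂ) : ‖Complex.sin z‖ ^ 2 = Real.sin z.re ^ 2 + Real.sinh z.im ^ 2 := by
  rw [← Complex.normSq_eq_norm_sq, Complex.normSq_apply, Complex.sin_eq z]
  simp [← Complex.ofReal_cos, ← Complex.ofReal_cosh, ← Complex.ofReal_sin, ← Complex.ofReal_sinh]
  nlinarith [Real.sin_sq_add_cos_sq z.re, Real.cosh_sq z.im]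

/-- Its contrapositive keeps arcsin of the disk of radius sin 1 inside 𝔻. Where |x| < 1, sinh² y ≥
y² ≥ (1 − x)(1 + x) ≥ sin(1 − x) sin(1 + x) = sin² 1 − sin² x. -/
lemma sin_one_le_norm_sin {z : ℂ} (hz : 1 ≤ ‖z‖) (hre : |z.re| < Real.pi / 2) :
    Real.sin 1 ≤ ‖Complex.sin z‖ := by
  refine le_of_sq_le_sq ?_ (norm_nonneg _)
  rw [norm_sin_sq]
  have hx : Real.sin z.re ^ 2 = Real.sin |z.re| ^ 2 := by
    rcases abs_cases z.re with ⟨h, -⟩ | ⟨h, -⟩ <;> simp [h]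
  rw [hx]
  set x := |z.re| with hxdef
  have hx0 : 0 ≤ x := abs_nonneg _
  rcases le_or_gt 1 x with h1 | h1
  · have h2 : Real.sin 1 ≤ Real.sin x :=
      Real.sin_le_sin_of_le_of_le_pi_div_two (by linarith [Real.pi_pos]) hre.le h1
    have h3 : 0 < Real.sin 1 := Real.sin_pos_of_pos_of_lt_pi one_pos (by linarith [Real.pi_gt_three])
    nlinarith [sq_nonneg (Real.sinh z.im)]
  · have hy : 1 - x ^ 2 ≤ z.im ^ 2 := by
      have h2 : (1 : ℝ) ≤ ‖z‖ ^ 2 := by nlinarith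
      rw [← Complex.normSq_eq_norm_sq, Complex.normSq_apply] at h2
      rw [hxdef, sq_abs]; linarith
    have hsinh : z.im ^ 2 ≤ Real.sinh z.im ^ 2 := by
      rw [← sq_abs, ← sq_abs (Real.sinh _), Real.abs_sinh]
      have := Real.self_le_sinh_iff.2 (abs_nonneg z.im)
      gcongr
    have hsin : Real.sin 1 ^ 2 - Real.sin x ^ 2 = Real.sin (1 - x) * Real.sin (1 + x) := by
      rw [Real.sin_sub, Real.sin_add]
      nlinarith [Real.sin_sq_add_cos_sq 1, Real.sin_sq_add_cos_sq x]
    have h2 : Real.sin (1 - x) * Real.sin (1 + x) ≤ (1 - x) * (1 + x) :=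
      mul_le_mul (Real.sin_le (by linarith)) (Real.sin_le (by linarith))
        (Real.sin_nonneg_of_nonneg_of_le_pi (by linarith) (by linarith [Real.pi_gt_three]))
        (by linarith)
    nlinarith

lemma differentiableOn_carcsin {c : ℝ} (hc : c ≤ 1) : DifferentiableOn ℂ carcsin (ball 0 c) :=
  fun u hu => by
  have hu1 : ‖u‖ < 1 := (mem_ball_zero_iff.1 hu).trans_le hc
  have h1 : DifferentiableAt ℂ (fun u : ℂ => (1 - u ^ 2) ^ (1 / 2 : ℂ)) u :=
    DifferentiableAt.cpow (by fun_prop) (by fun_prop) (one_sub_sq_mem_slitPlane hu1)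
  have h2 : DifferentiableAt ℂ (fun u : ℂ => Complex.I * u + (1 - u ^ 2) ^ (1 / 2 : ℂ)) u := by
    fun_prop
  exact ((h2.clog (I_mul_add_mem_slitPlane hu1)).const_mul (-Complex.I)).differentiableWithinAt

lemma mapsTo_carcsin : MapsTo carcsin (ball 0 (Real.sin 1)) unitDisk := fun u hu => by
  rw [mem_ball_zero_iff] at hu
  have hu1 := hu.trans_le (Real.sin_le_one 1)
  rw [mem_unitDisk]
  by_contra! h
  have := sin_one_le_norm_sin h (abs_re_carcsin_lt hu1)
  rw [sin_carcsin hu1] at this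
  linarith

lemma phiSin_ne {z : ℂ} (hz : z ∈ unitDisk) : phiSin z ≠ ((1 - Real.sin 1 : ℝ) : ℂ) := fun h => by
  have h1 : Complex.sin z = Complex.sin (-1) := by
    rw [phiSin] at h
    push_cast at h
    rw [Complex.sin_neg]
    linear_combination h
  have hz1 := mem_unitDisk.1 hz
  have hre := abs_lt.1 ((Complex.abs_re_le_norm z).trans_lt hz1)
  have hpi := Real.pi_gt_three
  have him : Real.cos z.re * Real.sinh z.im = 0 := by
    have := congrArg Complex.im h1
    rw [Complex.sin_eq z, show (-1 : ℂ) = ((-1 : ℝ) : ℂ) by simp] at this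
    simpa [← Complex.ofReal_cos, ← Complex.ofReal_cosh, ← Complex.ofReal_sin,
      ← Complex.ofReal_sinh, -Complex.ofReal_neg] using this
  have hc : Real.cos z.re ≠ 0 :=
    (Real.cos_pos_of_mem_Ioo ⟨by linarith, by linarith⟩).ne'
  have hy : z.im = 0 := Real.sinh_eq_zero.1 ((mul_eq_zero.1 him).resolve_left hc)
  have hzr : z = (z.re : ℂ) := Complex.ext (by simp) (by simp [hy])
  rw [hzr, show (-1 : ℂ) = ((-1 : ℝ) : ℂ) by simp, ← Complex.ofReal_sin, ← Complex.ofReal_sin,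
    Complex.ofReal_inj] at h1
  have := Real.sin_lt_sin_of_lt_of_le_pi_div_two (x := -1) (y := z.re) (by linarith) (by linarith)
    hre.1
  linarith

lemma sin_one_bounds : 0.8414 < Real.sin 1 ∧ Real.sin 1 < 0.8416 := by
  -- sin 1 is the imaginary part of exp(i); eight Taylor terms suffice.
  have h := Complex.exp_bound (x := Complex.I) (by simp) (n := 8) (by norm_num)
  have h2 := abs_le.1 ((Complex.abs_im_le_norm _).trans h)
  have e : (Complex.exp Complex.I).im = Real.sin 1 := by
    rw [Complex.exp_im]; simp
  have I3 : Complex.I ^ 3 = -Complex.I := Complex.I_pow_three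
  have I4 : Complex.I ^ 4 = 1 := Complex.I_pow_four
  have I5 : Complex.I ^ 5 = Complex.I := by rw [pow_succ, I4, one_mul]
  have I6 : Complex.I ^ 6 = -1 := by rw [pow_succ, I5, Complex.I_mul_I]
  have I7 : Complex.I ^ 7 = -Complex.I := by rw [pow_succ, I6]; ring
  have s : (∑ m ∈ Finset.range 8, Complex.I ^ m / (m.factorial : ℂ)).im =
      1 - 1 / 6 + 1 / 120 - 1 / 5040 := by
    simp [Finset.sum_range_succ, I3, I4, I5, I6, I7, Nat.factorial, Complex.normSq]
    norm_num
  rw [Complex.sub_im, e, s] at h2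
  norm_num [Nat.factorial] at h2
  constructor <;> linarith

/-! ### The lune -/

/-- The inverse of `u ↦ phiLune u - 1`. -/
noncomputable def luneInv (u : ℂ) : ℂ := ((1 + u) ^ 2 - 1) / (2 * (1 + u))

lemma sqrt_two_bounds : 1.41421 < √2 ∧ √2 < 1.41422 := by
  constructor
  · exact Real.lt_sqrt_of_sq_lt (by norm_num)
  · exact (Real.sqrt_lt' (by norm_num)).2 (by norm_num)

lemma one_add_ne_zero_of_norm_lt_one {u : ℂ} (hu : ‖u‖ < 1) : 1 + u ≠ 0 := fun h => by
  have : u = -1 := by linear_combination h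
  simp [this] at hu

lemma differentiableOn_luneInv {c : ℝ} (hc : c ≤ 1) : DifferentiableOn ℂ luneInv (ball 0 c) :=
  DifferentiableOn.div (by fun_prop) (by fun_prop) fun _ hu => mul_ne_zero two_ne_zero
    (one_add_ne_zero_of_norm_lt_one ((mem_ball_zero_iff.1 hu).trans_le hc))

/-- With w = 1 + u, |w² − 1|² − |2w|² = (|w − 1|² − 2)(|w + 1|² − 2): the lune lies inside one
circle of radius √2 and outside the other. -/
lemma mapsTo_luneInv : MapsTo luneInv (ball 0 (2 - √2)) unitDisk := fun u hu => by
  rw [mem_ball_zero_iff] at hu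
  have hs := sqrt_two_bounds
  have h0 := one_add_ne_zero_of_norm_lt_one (u := u) (by linarith)
  rw [mem_unitDisk, luneInv, norm_div, div_lt_one (norm_pos_iff.2 (mul_ne_zero two_ne_zero h0))]
  refine lt_of_pow_lt_pow_left₀ 2 (norm_nonneg _) ?_
  have h2 : 2 < ‖2 + u‖ ^ 2 := by
    have h3 := norm_sub_norm_le (2 : ℂ) (-u)
    rw [norm_neg, sub_neg_eq_add, Complex.norm_ofNat] at h3
    have h4 : √2 < ‖2 + u‖ := by linarith
    nlinarith [Real.sq_sqrt (zero_le_two (α := ℝ)), Real.sqrt_nonneg 2]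
  have h1 : ‖u‖ ^ 2 < 2 := by nlinarith [norm_nonneg u]
  have key : ‖(1 + u) ^ 2 - 1‖ ^ 2 - ‖2 * (1 + u)‖ ^ 2 = (‖u‖ ^ 2 - 2) * (‖2 + u‖ ^ 2 - 2) := by
    simp only [← Complex.normSq_eq_norm_sq, Complex.normSq_apply]
    simp [pow_two]
    ring
  nlinarith

lemma phiLune_luneInv {u : ℂ} (hu : ‖u‖ < 1) : phiLune (luneInv u) = 1 + u := by
  have h0 := one_add_ne_zero_of_norm_lt_one hu
  have hre : 0 < (1 + u).re := by
    have := abs_lt.1 ((Complex.abs_re_le_norm u).trans_lt hu)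
    rw [Complex.add_re, Complex.one_re]; linarith
  have e : 1 + luneInv u ^ 2 = (((1 + u) + (1 + u)⁻¹) / 2) ^ 2 := by
    rw [luneInv]; field_simp; ring
  have hinv : 0 < ((1 + u)⁻¹).re := by
    rw [Complex.inv_re]; exact div_pos hre (Complex.normSq_pos.2 h0)
  rw [phiLune, e, sq_cpow_half, luneInv]
  · field_simp; ring
  · rw [Complex.div_ofNat_re, Complex.add_re]; linarith

lemma phiLune_ne {z : ℂ} (hz : z ∈ unitDisk) : phiLune z ≠ ((√2 - 1 : ℝ) : ℂ) := fun h => by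
  have h1 := cpow_half_sq (1 + z ^ 2)
  have h2 : (((√2 : ℝ) : ℂ)) ^ 2 = 2 := by exact_mod_cast Real.sq_sqrt (zero_le_two (α := ℝ))
  rw [phiLune] at h
  push_cast at h
  set s : ℂ := ((√2 : ℝ) : ℂ) with hs
  rw [show (1 + z ^ 2) ^ (1 / 2 : ℂ) = s - 1 - z by linear_combination h] at h1
  have hsne : s - 1 ≠ 0 := fun h3 => by
    rw [show s = 1 by linear_combination h3] at h2; norm_num at h2
  have : (s - 1) * (z + 1) = 0 := by linear_combination (h2 - h1) / 2
  have hz1 : z = -1 := by linear_combination (mul_eq_zero.1 this).resolve_left hsne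
  exact neg_one_notMem_unitDisk (hz1 ▸ hz)

/-! ### The cardioid -/

/-- The inverse of `u ↦ phiC u - 1`. -/
noncomputable def cardioidInv (u : ℂ) : ℂ := (1 + 3 / 2 * u) ^ (1 / 2 : ℂ) - 1

lemma cardioid_mem_slitPlane {u : ℂ} (hu : u ∈ ball (0 : ℂ) (2 / 3)) :
    1 + 3 / 2 * u ∈ Complex.slitPlane := by
  left
  have := (re_abs_le_of_mem_ball hu).1
  rw [show (3 / 2 : ℂ) = ((3 / 2 : ℝ) : ℂ) by norm_num, Complex.add_re, Complex.re_ofReal_mul,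
    Complex.one_re]
  linarith

lemma differentiableOn_cardioidInv : DifferentiableOn ℂ cardioidInv (ball 0 (2 / 3)) :=
  fun u hu => by
  have h1 : DifferentiableAt ℂ (fun u : ℂ => (1 + 3 / 2 * u) ^ (1 / 2 : ℂ)) u :=
    DifferentiableAt.cpow (by fun_prop) (by fun_prop) (cardioid_mem_slitPlane hu)
  exact (h1.sub_const 1).differentiableWithinAt

/-- With s the root, |s − 1||s + 1| = (3/2)|u| < 1, and |s + 1| > 1 because Re s > 0. -/
lemma mapsTo_cardioidInv : MapsTo cardioidInv (ball 0 (2 / 3)) unitDisk := fun u hu => by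
  have hre := re_cpow_half_pos (cardioid_mem_slitPlane hu)
  have hsq := cpow_half_sq (1 + 3 / 2 * u)
  rw [mem_unitDisk, cardioidInv]
  set s := (1 + 3 / 2 * u) ^ (1 / 2 : ℂ)
  have h1 : 1 < ‖s + 1‖ := by
    have := Complex.re_le_norm (s + 1)
    rw [Complex.add_re, Complex.one_re] at this
    linarith
  have h2 : ‖s - 1‖ * ‖s + 1‖ = 3 / 2 * ‖u‖ := by
    rw [← norm_mul, show (s - 1) * (s + 1) = 3 / 2 * u by linear_combination hsq, norm_mul]
    norm_num
  rw [mem_ball_zero_iff] at hu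
  nlinarith [norm_nonneg (s - 1)]

lemma phiC_cardioidInv (u : ℂ) : phiC (cardioidInv u) = 1 + u := by
  rw [phiC, cardioidInv]
  linear_combination 2 / 3 * cpow_half_sq (1 + 3 / 2 * u)

lemma phiC_ne {z : ℂ} (hz : z ∈ unitDisk) : phiC z ≠ ((1 / 3 : ℝ) : ℂ) := fun h => by
  rw [phiC] at h
  push_cast at h
  have : (z + 1) ^ 2 = 0 := by linear_combination 3 / 2 * h
  have hz1 : z = -1 := by linear_combination pow_eq_zero_iff (two_ne_zero) |>.1 this
  exact neg_one_notMem_unitDisk (hz1 ▸ hz)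

/-! ### The rational function -/

/-- The inverse of `u ↦ phiR u - 1`. -/
noncomputable def ratInv (u : ℂ) : ℂ :=
  -- A root of z² + k(1 + u)z − k²u = 0, with the radical moved to the denominator so that its
  -- modulus is easily bounded.
  2 * ((√2 + 1 : ℝ) : ℂ) * u / ((1 + 6 * u + u ^ 2) ^ (1 / 2 : ℂ) + 1 + u)

lemma rat_mem_slitPlane {u : ℂ} (hu : u ∈ ball (0 : ℂ) (3 - 2 * √2)) :
    1 + 6 * u + u ^ 2 ∈ Complex.slitPlane := by
  have hre := (re_abs_le_of_mem_ball hu).1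
  have h2 : (((√2 : ℝ) : ℂ)) ^ 2 = 2 := by exact_mod_cast Real.sq_sqrt (zero_le_two (α := ℝ))
  have e : 1 + 6 * u + u ^ 2 =
      (u + ((3 - 2 * √2 : ℝ) : ℂ)) * (u + ((3 + 2 * √2 : ℝ) : ℂ)) := by
    push_cast
    linear_combination 4 * h2
  rw [e]
  apply mul_mem_slitPlane <;> rw [Complex.add_re, Complex.ofReal_re]
  · linarith
  · linarith [Real.sqrt_nonneg 2]

lemma re_rat_denom {u : ℂ} (hu : u ∈ ball (0 : ℂ) (3 - 2 * √2)) :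
    2 * √2 - 2 < ((1 + 6 * u + u ^ 2) ^ (1 / 2 : ℂ) + 1 + u).re := by
  have h1 := re_cpow_half_pos (rat_mem_slitPlane hu)
  have h2 := (re_abs_le_of_mem_ball hu).1
  rw [Complex.add_re, Complex.add_re, Complex.one_re]
  linarith

lemma rat_denom_ne_zero {u : ℂ} (hu : u ∈ ball (0 : ℂ) (3 - 2 * √2)) :
    (1 + 6 * u + u ^ 2) ^ (1 / 2 : ℂ) + 1 + u ≠ 0 := fun h => by
  have := re_rat_denom hu
  rw [h, Complex.zero_re] at this
  linarith [sqrt_two_bounds.1]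

lemma differentiableOn_ratInv : DifferentiableOn ℂ ratInv (ball 0 (3 - 2 * √2)) := fun u hu => by
  have h1 : DifferentiableAt ℂ (fun u : ℂ => (1 + 6 * u + u ^ 2) ^ (1 / 2 : ℂ)) u :=
    DifferentiableAt.cpow (by fun_prop) (by fun_prop) (rat_mem_slitPlane hu)
  have h2 : DifferentiableAt ℂ (fun u : ℂ => 2 * ((√2 + 1 : ℝ) : ℂ) * u) u := by fun_prop
  exact (h2.div ((h1.add_const 1).add differentiableAt_fun_id)
    (rat_denom_ne_zero hu)).differentiableWithinAt

/-- The numerator is below 2(√2 + 1)(√2 − 1)² = 2√2 − 2 in modulus, exactly the lower bound for the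
denominator. -/
lemma mapsTo_ratInv : MapsTo ratInv (ball 0 (3 - 2 * √2)) unitDisk := fun u hu => by
  have h1 := (re_rat_denom hu).trans_le (Complex.re_le_norm _)
  have h2 := Real.sq_sqrt (zero_le_two (α := ℝ))
  have h3 := sqrt_two_bounds.1
  rw [mem_unitDisk, ratInv, norm_div, norm_mul, norm_mul, Complex.norm_ofNat, Complex.norm_real,
    Real.norm_of_nonneg (by linarith), div_lt_one (by linarith)]
  rw [mem_ball_zero_iff] at hu
  nlinarith

lemma rat_pole_ne_zero {z : ℂ} (hz : z ∈ unitDisk) :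
    ((√2 + 1 : ℝ) : ℂ) ^ 2 - ((√2 + 1 : ℝ) : ℂ) * z ≠ 0 := by
  have h3 := sqrt_two_bounds.1
  rw [show ((√2 + 1 : ℝ) : ℂ) ^ 2 - ((√2 + 1 : ℝ) : ℂ) * z =
    ((√2 + 1 : ℝ) : ℂ) * (((√2 + 1 : ℝ) : ℂ) - z) by ring]
  refine mul_ne_zero (Complex.ofReal_ne_zero.2 (by linarith)) fun h => ?_
  rw [mem_unitDisk, ← sub_eq_zero.1 h, Complex.norm_real, Real.norm_of_nonneg (by linarith)] at hz
  linarith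

lemma phiR_ratInv {u : ℂ} (hu : u ∈ ball (0 : ℂ) (3 - 2 * √2)) : phiR (ratInv u) = 1 + u := by
  have hp := rat_pole_ne_zero (mapsTo_ratInv hu)
  have hd := rat_denom_ne_zero hu
  have hsq := cpow_half_sq (1 + 6 * u + u ^ 2)
  rw [phiR, add_right_inj, div_eq_iff hp, ratInv]
  set k : ℂ := ((√2 + 1 : ℝ) : ℂ)
  set D := (1 + 6 * u + u ^ 2) ^ (1 / 2 : ℂ)
  field_simp
  linear_combination -(k ^ 2 * u) * hsq

lemma phiR_ne {z : ℂ} (hz : z ∈ unitDisk) : phiR z ≠ ((2 * (√2 - 1) : ℝ) : ℂ) := fun h => by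
  have hp := rat_pole_ne_zero hz
  have h2 : (((√2 : ℝ) : ℂ)) ^ 2 = 2 := by exact_mod_cast Real.sq_sqrt (zero_le_two (α := ℝ))
  rw [phiR, ← eq_sub_iff_add_eq', div_eq_iff hp] at h
  push_cast at h
  set s : ℂ := ((√2 : ℝ) : ℂ)
  have : (z + 1) ^ 2 = 0 := by linear_combination h + (2 * s + 1 - 2 * z) * h2
  have hz1 : z = -1 := by linear_combination pow_eq_zero_iff (two_ne_zero) |>.1 this
  exact neg_one_notMem_unitDisk (hz1 ▸ hz)

/-! ### The parabola -/

/-- The entire function `v ↦ cosh √v`. -/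
noncomputable def coshSqrt (v : ℂ) : ℂ := Complex.cosh (v ^ (1 / 2 : ℂ))

lemma coshSqrt_sq (x : ℂ) : coshSqrt (x ^ 2) = Complex.cosh x := by
  rw [coshSqrt]
  rcases sq_eq_sq_iff_eq_or_eq_neg.1 (cpow_half_sq (x ^ 2)) with h | h <;> rw [h]
  exact Complex.cosh_neg x

/-- Since cosh is even, near v ≠ 0 the principal root may be replaced by the analytic branch b√(w/v)
with b² = v. At 0 continuity suffices, the singularity being removable. -/
lemma differentiable_coshSqrt : Differentiable ℂ coshSqrt := by
  rw [← differentiableOn_univ,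
    ← Complex.differentiableOn_compl_singleton_and_continuousAt_iff (c := 0) Filter.univ_mem]
  constructor
  · intro v hv
    have hv0 : v ≠ 0 := hv.2
    obtain ⟨b, hb⟩ : ∃ b : ℂ, b ^ 2 = v := ⟨_, cpow_half_sq v⟩
    have hb0 : b ≠ 0 := fun h => hv0 (by rw [← hb, h]; simp)
    have e : coshSqrt = fun w => Complex.cosh (b * (w / v) ^ (1 / 2 : ℂ)) := by
      funext w
      rw [← coshSqrt_sq, mul_pow, cpow_half_sq, hb, mul_div_cancel₀ _ hv0]
    have hd : DifferentiableAt ℂ (fun w : ℂ => (w / v) ^ (1 / 2 : ℂ)) v :=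
      DifferentiableAt.cpow (by fun_prop) (by fun_prop) (by simp [hv0])
    rw [e]
    exact (hd.const_mul b).ccosh.differentiableWithinAt
  · refine Complex.continuous_cosh.continuousAt.comp ?_
    exact Complex.continuousAt_cpow_const_of_re_pos (by simp) (by norm_num)

/-- The inverse of `u ↦ phiP u - 1`. -/
noncomputable def parabolaInv (u : ℂ) : ℂ :=
  -- This is tanh² b with b² = π²u/8, by the half-argument formula; `coshSqrt` avoids choosing a
  -- branch of b.
  (coshSqrt ((Real.pi : ℂ) ^ 2 * u / 2) - 1) / (coshSqrt ((Real.pi : ℂ) ^ 2 * u / 2) + 1)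

/-- |cosh b|² − |sinh b|² = cos(2 Im b), so tanh maps this strip into 𝔻. -/
lemma norm_sinh_lt_norm_cosh {b : ℂ} (hb : |b.im| < Real.pi / 4) :
    ‖Complex.sinh b‖ < ‖Complex.cosh b‖ := by
  refine lt_of_pow_lt_pow_left₀ 2 (norm_nonneg _) ?_
  have e : ‖Complex.cosh b‖ ^ 2 - ‖Complex.sinh b‖ ^ 2 = Real.cos (2 * b.im) := by
    rw [← Complex.re_add_im b, Complex.cosh_add, Complex.sinh_add, Complex.cosh_mul_I,
      Complex.sinh_mul_I]
    simp only [← Complex.normSq_eq_norm_sq, Complex.normSq_apply]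
    simp [← Complex.ofReal_cos, ← Complex.ofReal_cosh, ← Complex.ofReal_sin,
      ← Complex.ofReal_sinh]
    rw [Real.cos_two_mul, ← sub_eq_zero]
    have h1 := Real.cosh_sq b.re
    have h2 := Real.sin_sq b.im
    linear_combination (Real.cos b.im ^ 2 - Real.sin b.im ^ 2) * h1 - h2
  have h := abs_lt.1 hb
  have := Real.cos_pos_of_mem_Ioo (x := 2 * b.im) ⟨by linarith, by linarith⟩
  linarith

lemma exists_parabolaInv_eq {u : ℂ} (hu : ‖u‖ < 1 / 2) : ∃ b : ℂ, |b.im| < Real.pi / 4 ∧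
    b ^ 2 = (Real.pi : ℂ) ^ 2 * u / 8 ∧ coshSqrt ((Real.pi : ℂ) ^ 2 * u / 2) + 1 ≠ 0 ∧
    parabolaInv u = (Complex.sinh b / Complex.cosh b) ^ 2 := by
  set b : ℂ := ((Real.pi : ℂ) ^ 2 * u / 8) ^ (1 / 2 : ℂ)
  have hb : b ^ 2 = (Real.pi : ℂ) ^ 2 * u / 8 := cpow_half_sq _
  have him : |b.im| < Real.pi / 4 := by
    refine (Complex.abs_im_le_norm b).trans_lt ?_
    refine lt_of_pow_lt_pow_left₀ 2 (by positivity) ?_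
    rw [← norm_pow, hb, norm_div, norm_mul, norm_pow, Complex.norm_real, Complex.norm_ofNat,
      Real.norm_of_nonneg Real.pi_pos.le]
    nlinarith [pow_pos Real.pi_pos 2]
  have hc : Complex.cosh b ≠ 0 := norm_pos_iff.1 ((norm_nonneg _).trans_lt
    (norm_sinh_lt_norm_cosh him))
  have e : coshSqrt ((Real.pi : ℂ) ^ 2 * u / 2) = Complex.cosh (2 * b) := by
    rw [← coshSqrt_sq]; congr 1; linear_combination -4 * hb
  have e1 : coshSqrt ((Real.pi : ℂ) ^ 2 * u / 2) + 1 = 2 * Complex.cosh b ^ 2 := by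
    rw [e, Complex.cosh_two_mul, Complex.sinh_sq]; ring
  have e2 : coshSqrt ((Real.pi : ℂ) ^ 2 * u / 2) - 1 = 2 * Complex.sinh b ^ 2 := by
    rw [e, Complex.cosh_two_mul, Complex.cosh_sq]; ring
  refine ⟨b, him, hb, by rw [e1]; simpa using hc, ?_⟩
  rw [parabolaInv, e1, e2, mul_div_mul_left _ _ two_ne_zero, div_pow]

lemma differentiableOn_parabolaInv : DifferentiableOn ℂ parabolaInv (ball 0 (1 / 2)) := by
  have h : DifferentiableOn ℂ (fun u => coshSqrt ((Real.pi : ℂ) ^ 2 * u / 2)) (ball 0 (1 / 2)) :=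
    differentiable_coshSqrt.comp_differentiableOn (by fun_prop)
  exact (h.sub_const 1).div (h.add_const 1) fun u hu => by
    obtain ⟨b, -, -, hne, -⟩ := exists_parabolaInv_eq (mem_ball_zero_iff.1 hu)
    exact hne

lemma mapsTo_parabolaInv : MapsTo parabolaInv (ball 0 (1 / 2)) unitDisk := fun u hu => by
  obtain ⟨b, him, -, -, he⟩ := exists_parabolaInv_eq (mem_ball_zero_iff.1 hu)
  have h := norm_sinh_lt_norm_cosh him
  rw [mem_unitDisk, he, norm_pow, norm_div]
  exact pow_lt_one₀ (by positivity) ((div_lt_one ((norm_nonneg _).trans_lt h)).2 h) two_ne_zero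

lemma log_one_add_tanh_div {b : ℂ} (hb : |b.im| < Real.pi / 4) :
    Complex.log ((1 + Complex.sinh b / Complex.cosh b) / (1 - Complex.sinh b / Complex.cosh b)) =
      2 * b := by
  have hc : Complex.cosh b ≠ 0 := norm_pos_iff.1 ((norm_nonneg _).trans_lt
    (norm_sinh_lt_norm_cosh hb))
  have e : (1 + Complex.sinh b / Complex.cosh b) / (1 - Complex.sinh b / Complex.cosh b) =
      Complex.exp (2 * b) := by
    rw [one_add_div hc, one_sub_div hc, div_div_div_cancel_right₀ hc, Complex.cosh_add_sinh,
      Complex.cosh_sub_sinh, ← Complex.exp_sub]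
    congr 1; ring
  have h := abs_lt.1 hb
  rw [e, Complex.log_exp] <;> simp <;> linarith [Real.pi_pos]

lemma phiP_parabolaInv {u : ℂ} (hu : ‖u‖ < 1 / 2) : phiP (parabolaInv u) = 1 + u := by
  obtain ⟨b, him, hb, -, he⟩ := exists_parabolaInv_eq hu
  have hpi : (Real.pi : ℂ) ≠ 0 := Complex.ofReal_ne_zero.2 Real.pi_ne_zero
  -- The principal root of tanh² b is tanh b or tanh(−b); the sign disappears when the logarithm is
  -- squared.
  obtain ⟨c, hc, hcb, hroot⟩ : ∃ c : ℂ, |c.im| < Real.pi / 4 ∧ c ^ 2 = b ^ 2 ∧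
      parabolaInv u ^ (1 / 2 : ℂ) = Complex.sinh c / Complex.cosh c := by
    rcases sq_eq_sq_iff_eq_or_eq_neg.1 ((cpow_half_sq (parabolaInv u)).trans he) with h | h
    · exact ⟨b, him, rfl, h⟩
    · exact ⟨-b, by simpa using him, neg_sq b, by
        rw [h, Complex.sinh_neg, Complex.cosh_neg, neg_div]⟩
  rw [phiP, hroot, log_one_add_tanh_div hc, mul_pow, hcb, hb]
  field_simp
  ring

lemma phiP_ne {z : ℂ} (hz : z ∈ unitDisk) : phiP z ≠ ((1 / 2 : ℝ) : ℂ) := fun h => by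
  have hpi : (Real.pi : ℂ) ≠ 0 := Complex.ofReal_ne_zero.2 Real.pi_ne_zero
  rw [phiP] at h
  push_cast at h
  have ht := cpow_half_sq z
  set t := z ^ (1 / 2 : ℂ)
  set w := (1 + t) / (1 - t) with hw
  have hL : Complex.log w ^ 2 = ((Real.pi : ℂ) / 2 * Complex.I) ^ 2 := by
    rw [mul_pow, Complex.I_sq]
    field_simp at h
    linear_combination h / 4
  have hL0 : Complex.log w ≠ 0 := fun h0 => by
    rw [h0, zero_pow two_ne_zero] at hL
    exact pow_ne_zero 2 (mul_ne_zero (div_ne_zero hpi two_ne_zero) Complex.I_ne_zero) hL.symm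
  -- By convention log 0 = 0 and division by 0 gives 0, so log w ≠ 0 rules out both w = 0 and t = 1.
  have hw0 : w ≠ 0 := fun h0 => hL0 (by rw [h0, Complex.log_zero])
  have hwsq : w ^ 2 = -1 := by
    rw [← Complex.exp_log hw0]
    rcases sq_eq_sq_iff_eq_or_eq_neg.1 hL with h1 | h1
    · rw [h1, Complex.exp_pi_div_two_mul_I, Complex.I_sq]
    · rw [h1, Complex.exp_neg, Complex.exp_pi_div_two_mul_I, Complex.inv_I, neg_sq, Complex.I_sq]
  have h1t : 1 - t ≠ 0 := fun h0 => hw0 (by rw [hw, h0, div_zero])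
  rw [hw, div_pow, div_eq_iff (pow_ne_zero 2 h1t)] at hwsq
  have hz1 : z = -1 := by linear_combination hwsq / 2 - ht
  exact neg_one_notMem_unitDisk (hz1 ▸ hz)

end StarRadius

/-! ### Assembly and numerical values -/

theorem theorem2 :
    (∀ α : ℝ, 0 ≤ α → α < 1 →
      IsLeast {r : ℝ | 0 < r ∧
          (3 - α) * r ^ 3 + (2 * α - 1) * r ^ 2 - (8 - α) * r + 2 - 2 * α = 0}
        (radius (starlikeOrder α) classF2) ∧
      IsExtremal (starlikeOrder α) classF2 f2 ∧
      starQuot f2 (-(radius (starlikeOrder α) classF2 : ℂ)) = (α : ℂ)) ∧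
    (radius (starlikeSub phiP) classF2 = radius (starlikeOrder (1 / 2)) classF2 ∧
      IsExtremal (starlikeSub phiP) classF2 f2 ∧
      |radius (starlikeSub phiP) classF2 - 0.1341| < 0.0001) ∧
    (radius (starlikeSub phiE) classF2 = radius (starlikeOrder (1 / Real.exp 1)) classF2 ∧
      IsExtremal (starlikeSub phiE) classF2 f2 ∧
      |radius (starlikeSub phiE) classF2 - 0.16628| < 0.00001) ∧
    (radius (starlikeSub phiSin) classF2 = radius (starlikeOrder (1 - Real.sin 1)) classF2 ∧
      IsExtremal (starlikeSub phiSin) classF2 f2 ∧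
      |radius (starlikeSub phiSin) classF2 - 0.2142| < 0.0001) ∧
    (radius (starlikeSub phiLune) classF2 = radius (starlikeOrder (√2 - 1)) classF2 ∧
      IsExtremal (starlikeSub phiLune) classF2 f2 ∧
      |radius (starlikeSub phiLune) classF2 - 0.1551| < 0.0001) ∧
    (radius (starlikeSub phiR) classF2 = radius (starlikeOrder (2 * (√2 - 1))) classF2 ∧
      IsExtremal (starlikeSub phiR) classF2 f2 ∧
      |radius (starlikeSub phiR) classF2 - 0.0481| < 0.0001) ∧
    (radius (starlikeSub phiC) classF2 = radius (starlikeOrder (1 / 3)) classF2 ∧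
      IsExtremal (starlikeSub phiC) classF2 f2 ∧
      |radius (starlikeSub phiC) classF2 - 0.1744| < 0.0001) := by
  have he := Real.exp_one_gt_d9
  have he' := Real.exp_one_lt_d9
  have hs := sqrt_two_bounds
  have hsin := sin_one_bounds
  have hexp : 0 < Real.exp 1 := Real.exp_pos 1
  refine ⟨fun α h0 h1 => ?_, ?_, ?_, ?_, ?_, ?_, ?_⟩
  · obtain ⟨ρ, hρ0, hρ1, hρ⟩ := exists_starDeviation_eq h1
    obtain ⟨e, hext⟩ := radius_starlikeOrder h0 hρ0 hρ1 hρ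
    refine ⟨e ▸ isLeast_cubic_root hρ0 hρ1 hρ, hext, ?_⟩
    rw [e, starQuot_f2_neg hρ0 hρ1, hρ, sub_sub_cancel]
  · have e : (1 : ℝ) - 1 / 2 = 1 / 2 := by norm_num
    refine radius_starlikeSub (ψ := parabolaInv) (by norm_num) (by norm_num)
      (by rw [e]; exact differentiableOn_parabolaInv) (by rw [e]; exact mapsTo_parabolaInv)
      (by simp [parabolaInv, coshSqrt])
      (fun u hu => phiP_parabolaInv (by rwa [e, mem_ball_zero_iff] at hu)) (fun z hz => phiP_ne hz)
      ?_ ?_ ?_ ?_ ?_ <;> norm_num [starDeviation]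
  · have hlo : 0.36787 < 1 / Real.exp 1 := by rw [lt_div_iff₀ hexp]; linarith
    have hhi : 1 / Real.exp 1 < 0.36788 := by rw [div_lt_iff₀ hexp]; linarith
    refine radius_starlikeSub (ψ := fun u => Complex.log (1 + u)) (by linarith) (by linarith)
      (differentiableOn_log_one_add (by linarith)) mapsTo_log_one_add (by simp)
      (fun u hu => phiE_log ((mem_ball_zero_iff.1 hu).trans_le (by linarith)))
      (fun z hz => phiE_ne hz) ?_ ?_ ?_ ?_ ?_
    · norm_num
    · norm_num
    · norm_num
    -- A rational number between D(x − ε) and 1 − α reduces the comparison to rational arithmetic;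
    -- the other irrational α are treated alike.
    · refine lt_trans ?_ (show (0.63212 : ℝ) < _ by linarith)
      norm_num [starDeviation]
    · refine lt_trans (show _ < (0.63213 : ℝ) by linarith) ?_
      norm_num [starDeviation]
  · have e : (1 : ℝ) - (1 - Real.sin 1) = Real.sin 1 := sub_sub_cancel _ _
    refine radius_starlikeSub (ψ := carcsin) (by linarith) (by linarith)
      (differentiableOn_carcsin (by linarith)) (by rw [e]; exact mapsTo_carcsin)
      (by simp [carcsin])
      (fun u hu => by
        rw [phiSin, sin_carcsin ((mem_ball_zero_iff.1 hu).trans_le (by linarith))])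
      (fun z hz => phiSin_ne hz) ?_ ?_ ?_ ?_ ?_
    · norm_num
    · norm_num
    · norm_num
    · refine lt_trans ?_ (show (0.8414 : ℝ) < _ by linarith)
      norm_num [starDeviation]
    · refine lt_trans (show _ < (0.8416 : ℝ) by linarith) ?_
      norm_num [starDeviation]
  · have e : 1 - (√2 - 1) = 2 - √2 := by ring
    refine radius_starlikeSub (ψ := luneInv) (by linarith) (by linarith)
      (differentiableOn_luneInv (by linarith)) (by rw [e]; exact mapsTo_luneInv) (by simp [luneInv])
      (fun u hu => phiLune_luneInv ((mem_ball_zero_iff.1 hu).trans_le (by linarith)))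
      (fun z hz => phiLune_ne hz) ?_ ?_ ?_ ?_ ?_
    · norm_num
    · norm_num
    · norm_num
    · refine lt_trans ?_ (show (0.58578 : ℝ) < _ by linarith)
      norm_num [starDeviation]
    · refine lt_trans (show _ < (0.58579 : ℝ) by linarith) ?_
      norm_num [starDeviation]
  · have e : 1 - 2 * (√2 - 1) = 3 - 2 * √2 := by ring
    refine radius_starlikeSub (ψ := ratInv) (by linarith) (by linarith)
      (by rw [e]; exact differentiableOn_ratInv) (by rw [e]; exact mapsTo_ratInv) (by simp [ratInv])
      (fun u hu => phiR_ratInv (e ▸ hu)) (fun z hz => phiR_ne hz) ?_ ?_ ?_ ?_ ?_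
    · norm_num
    · norm_num
    · norm_num
    · refine lt_trans ?_ (show (0.17156 : ℝ) < _ by linarith)
      norm_num [starDeviation]
    · refine lt_trans (show _ < (0.17158 : ℝ) by linarith) ?_
      norm_num [starDeviation]
  · have e : (1 : ℝ) - 1 / 3 = 2 / 3 := by norm_num
    refine radius_starlikeSub (ψ := cardioidInv) (by norm_num) (by norm_num)
      (by rw [e]; exact differentiableOn_cardioidInv) (by rw [e]; exact mapsTo_cardioidInv) (by simp [cardioidInv])
      (fun u _ => phiC_cardioidInv u) (fun z hz => phiC_ne hz) ?_ ?_ ?_ ?_ ?_ <;>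
      norm_num [starDeviation]
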